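/- Let $m,n\ge 1$ be integers, $1<p_1,\dots,p_m<\infty$, $\vec P=(p_1,\dots,p_m)$, $\frac1p=\frac1{p_1}+\cdots+\frac1{p_m}$, $0<\alpha<mn$, $\frac1m<p<\frac n\alpha$ and $\frac1q=\frac1p-\frac\alpha n$; write $p_i'=p_i/(p_i-1)$. For measurable functions $\vec f=(f_1,\dots,f_m)$ on $\mathbb R^n$ put $$\mathcal M_\alpha(\vec f)(x)=\sup_{Q\ni x}\prod_{i=1}^m\frac1{|Q|^{1-\frac{\alpha}{mn}}}\int_Q|f_i(y_i)|\,dy_i ,$$ and for measurable $\vec\omega=(\omega_1,\dots,\omega_m)$ with each $\omega_i:\mathbb R^n\to[0,\infty)$ put $\nu_{\vec\omega}=\prod_{i=1}^m\omega_i$ and $$[\vec\omega]_{A_{(\vec P,q)}}=\sup_Q\Big(\frac1{|Q|}\int_Q\nu_{\vec\omega}^q\Big)\prod_{i=1}^m\Big(\frac1{|Q|}\int_Q\omega_i^{-p_i'}\Big)^{q/p_i'},$$ the suprema being over cubes $Q\subset\mathbb R^n$ with sides parallel to the axes (containing $x$ in the first case); $\vec\omega\in A_{(\vec P,q)}$ means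 $[\vec\omega]_{A_{(\vec P,q)}}<\infty$. Call $\gamma\in\mathbb R$ admissible if there is a constant $C=C(n,m,\vec P,q)<\infty$ such that $$\|\mathcal M_\alpha(\vec f)\|_{L^q(\nu_{\vec\omega}^q)}\le C\,[\vec\omega]_{A_{(\vec P,q)}}^{\gamma}\prod_{i=1}^m\|f_i\|_{L^{p_i}(\omega_i^{p_i})}$$ for all $\vec\omega\in A_{(\vec P,q)}$ and all measurable $\vec f$, and let the best power $\gamma(p_1,\dots,p_m)$ be the infimum of the admissible powers. Then $\frac1q\big(1-\frac{\alpha}{mn}\big)\max\{p_1',\dots,p_m'\}$ is admissible, no number smaller than $\frac{mp}{q(mp-1)}\big(1-\frac\alpha{mn}\big)$ is admissible, and consequently $$\frac{mp}{q(mp-1)}\Big(1-\frac{\alpha}{mn}\Big)\le\gamma(p_1,\dots,p_m)\le\frac1q\Big(1-\frac{\alpha}{mn}\Big)\max\{p_1',\dots,p_m'\}.$$ In particular, if $p_1=\cdots=p_m=r$, then $\gamma(r,\dots,r)=\frac{r'}{q}\big(1-\frac{\alpha}{mn}\big)$, and this power is sharp: it is the smallest admissible power. -/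

import Mathlib

open MeasureTheory
open scoped ENNReal NNReal

noncomputable section

namespace MultilinearFractional

/-- The closed cube in `ℝⁿ` with sides parallel to the axes, lower corner `a` and side length `ℓ`
(used only for `0 < ℓ`). -/
def cube {n : ℕ} (a : Fin n → ℝ) (ℓ : ℝ) : Set (Fin n → ℝ) :=
  {x | ∀ j, a j ≤ x j ∧ x j ≤ a j + ℓ}

/-- The multilinear fractional maximal operator
`M_α(f₁, …, f_m)(x) = sup_{Q ∋ x} ∏ᵢ |Q|^{-(1 - α/(mn))} ∫_Q |fᵢ|`, with values in `[0, ∞]`;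
the supremum is over all cubes with sides parallel to the axes that contain `x`. -/
def fracMaximal {n m : ℕ} (α : ℝ) (f : Fin m → (Fin n → ℝ) → ℂ) (x : Fin n → ℝ) : ℝ≥0∞ :=
  ⨆ (a : Fin n → ℝ) (ℓ : ℝ) (_ : 0 < ℓ) (_ : x ∈ cube a ℓ),
    ∏ i, (volume (cube a ℓ) ^ (1 - α / ((m : ℝ) * n)))⁻¹ * ∫⁻ y in cube a ℓ, ‖f i y‖ₑ

/-- The product weight `ν_ω = ∏ᵢ ωᵢ`. -/
def prodWeight {n m : ℕ} (ω : Fin m → (Fin n → ℝ) → ℝ≥0) (x : Fin n → ℝ) : ℝ≥0∞ :=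
  ∏ i, (ω i x : ℝ≥0∞)

/-- The `A_{(P,q)}` constant
`sup_Q (⨍_Q ν_ω^q) ∏ᵢ (⨍_Q ωᵢ^{-pᵢ'})^{q/pᵢ'}`, with values in `[0, ∞]`
(so that `ωᵢ^{-pᵢ'} = ∞` where `ωᵢ = 0`). -/
def weightConst {n m : ℕ} (p : Fin m → ℝ) (q : ℝ) (ω : Fin m → (Fin n → ℝ) → ℝ≥0) : ℝ≥0∞ :=
  ⨆ (a : Fin n → ℝ) (ℓ : ℝ) (_ : 0 < ℓ),
    (⨍⁻ x in cube a ℓ, prodWeight ω x ^ q ∂volume) *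
      ∏ i, (⨍⁻ x in cube a ℓ, (ω i x : ℝ≥0∞) ^ (-(p i).conjExponent) ∂volume) ^
        (q / (p i).conjExponent)

/-- The class `A_{(P,q)}` of multiple weights. -/
def IsWeight {n m : ℕ} (p : Fin m → ℝ) (q : ℝ) (ω : Fin m → (Fin n → ℝ) → ℝ≥0) : Prop :=
  (∀ i, AEMeasurable (ω i) volume) ∧ weightConst p q ω < ∞

/-- The set of all powers `γ` for which there is a constant `C`, independent of the weights and of
the functions, such that
`‖M_α(f)‖_{L^q(ν_ω^q)} ≤ C [ω]_{A_{(P,q)}}^γ ∏ᵢ ‖fᵢ‖_{L^{pᵢ}(ωᵢ^{pᵢ})}`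
for all `ω ∈ A_{(P,q)}` on `ℝⁿ` and all measurable `f₁, …, f_m`. -/
def admissiblePowers (n : ℕ) {m : ℕ} (α : ℝ) (p : Fin m → ℝ) (q : ℝ) : Set ℝ :=
  {γ | ∃ C : ℝ≥0, ∀ ω : Fin m → (Fin n → ℝ) → ℝ≥0, IsWeight p q ω →
    ∀ f : Fin m → (Fin n → ℝ) → ℂ, (∀ i, AEMeasurable (f i) volume) →
      eLpNorm (fracMaximal α f) (ENNReal.ofReal q)
          (volume.withDensity fun x => prodWeight ω x ^ q) ≤
        C * weightConst p q ω ^ γ *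
          ∏ i, eLpNorm (f i) (ENNReal.ofReal (p i))
            (volume.withDensity fun x => (ω i x : ℝ≥0∞) ^ p i)}

/-- The best power: the infimum of the admissible powers. -/
def bestPower (n : ℕ) {m : ℕ} (α : ℝ) (p : Fin m → ℝ) (q : ℝ) : ℝ :=
  sInf (admissiblePowers n α p q)

end MultilinearFractional

end

/-!
Upper bound: put `σᵢ = ωᵢ ^ (-pᵢ')` and `v = ν_ω ^ q`, so that `v ^ (1/q) ∏ᵢ σᵢ ^ (1/pᵢ') = 1`.
Split the order as `α/n = ∑ᵢ rᵢ` with `0 ≤ rᵢ < 1/pᵢ`. Hölder's inequality for the duality of `v`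
and `σ`, together with the `A_{(P,q)}` condition, then dominates `M_α(f)` by a product of powers of
centered maximal functions, taken with respect to `v dx` and to the `σᵢ dx`. By Besicovitch's
covering theorem these are bounded with constants that do not depend on the measure, so the weights
enter only through the power of `[ω]` that the domination costs.

Lower bound: for `δ → 0` the weights `‖x‖ ^ ((n - δ) / pᵢ')` and the functions
`fᵢ = ‖x‖ ^ (δ - n) 1_B` make both sides of the inequality, and `[ω]`, explicit powers of `1 / δ`.
-/

namespace MultilinearFractional

/-! ### Centered maximal functions -/

section LayerCake

theorem ofReal_mul_rpow_sub_one_eq {p t : ℝ} (hp : 1 < p) (ht : 0 < t) :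
    ENNReal.ofReal (p * t ^ (p - 1)) =
      ENNReal.ofReal (p / (p - 1)) *
        (ENNReal.ofReal ((p - 1) * t ^ (p - 1 - 1)) * ENNReal.ofReal t) := by
  have hp1 : 0 < p - 1 := by linarith
  rw [← ENNReal.ofReal_mul (by positivity), ← ENNReal.ofReal_mul (by positivity),
    Real.rpow_sub_one ht.ne' (p - 1)]
  congr 1
  field_simp

theorem setLIntegral_Ioo_ofReal_mul_rpow {p b : ℝ} (hp : 0 < p) (hb : 0 ≤ b) :
    ∫⁻ t in Set.Ioo 0 b, ENNReal.ofReal (p * t ^ (p - 1)) = ENNReal.ofReal b ^ p := by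
  have hint : IntervalIntegrable (fun t : ℝ => p * t ^ (p - 1)) volume 0 b :=
    (intervalIntegral.intervalIntegrable_rpow' (by linarith)).const_mul p
  have hnonneg : 0 ≤ᵐ[volume.restrict (Set.Ioc 0 b)] fun t : ℝ => p * t ^ (p - 1) := by
    filter_upwards [ae_restrict_mem measurableSet_Ioc] with t ht
    have := ht.1
    positivity
  rw [restrict_Ioo_eq_restrict_Ioc, ← ofReal_integral_eq_lintegral_ofReal hint.1 hnonneg,
    ← intervalIntegral.integral_of_le hb, intervalIntegral.integral_const_mul,
    integral_rpow (.inl (by linarith)), ENNReal.ofReal_rpow_of_nonneg hb hp.le,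
    sub_add_cancel, Real.zero_rpow hp.ne', sub_zero, mul_div_cancel₀ _ hp.ne']

theorem lintegral_Ioi_mul_indicator_ofReal_lt_ofReal {p b : ℝ} (hp : 0 < p) (hb : 0 ≤ b) :
    ∫⁻ t in Set.Ioi (0 : ℝ), ENNReal.ofReal (p * t ^ (p - 1)) *
      {t | ENNReal.ofReal t < ENNReal.ofReal b}.indicator 1 t = ENNReal.ofReal b ^ p := by
  rw [← setLIntegral_Ioo_ofReal_mul_rpow hp hb, ← lintegral_indicator measurableSet_Ioi,
    ← lintegral_indicator measurableSet_Ioo]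
  congr 1 with t
  by_cases h0 : 0 < t
  · simp [Set.indicator, h0, ENNReal.ofReal_lt_ofReal_iff_of_nonneg h0.le]
  · simp [Set.indicator, h0]

theorem lintegral_Ioi_mul_indicator_ofReal_lt {p : ℝ} (hp : 0 < p) (a : ℝ≥0∞) :
    ∫⁻ t in Set.Ioi (0 : ℝ), ENNReal.ofReal (p * t ^ (p - 1)) *
      {t | ENNReal.ofReal t < a}.indicator 1 t = a ^ p := by
  induction a with
  | coe a => simpa using lintegral_Ioi_mul_indicator_ofReal_lt_ofReal hp a.2
  | top =>
    have hN (N : ℕ) : (N : ℝ≥0∞) ^ p ≤ ∫⁻ t in Set.Ioi (0 : ℝ),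
        ENNReal.ofReal (p * t ^ (p - 1)) * {t | ENNReal.ofReal t < ∞}.indicator 1 t := by
      rw [← ENNReal.ofReal_natCast,
        ← lintegral_Ioi_mul_indicator_ofReal_lt_ofReal hp N.cast_nonneg]
      gcongr
      exact le_top
    have hlim := ((ENNReal.continuous_rpow_const (y := p)).tendsto ∞).comp
      ENNReal.tendsto_nat_nhds_top
    rw [ENNReal.top_rpow_of_pos hp] at hlim ⊢
    exact top_le_iff.1 (le_of_tendsto' hlim hN)

variable {E : Type*} [MeasurableSpace E]

theorem measurable_indicator_ofReal_lt {g : E → ℝ≥0∞} (hg : Measurable g) :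
    Measurable fun z : E × ℝ => {t | ENNReal.ofReal t < g z.1}.indicator (1 : ℝ → ℝ≥0∞) z.2 :=
  (measurable_one (α := ℝ≥0∞)).indicator
    (s := {z : E × ℝ | ENNReal.ofReal z.2 < g z.1}) (measurableSet_lt (by fun_prop) (by fun_prop))

theorem lintegral_mul_rpow_eq_lintegral_lt (μ : Measure E) [SFinite μ] {f g : E → ℝ≥0∞}
    (hf : Measurable f) (hg : Measurable g) {p : ℝ} (hp : 0 < p) :
    ∫⁻ x, f x * g x ^ p ∂μ = ∫⁻ t in Set.Ioi (0 : ℝ), ENNReal.ofReal (p * t ^ (p - 1)) *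
      ∫⁻ x in {x | ENNReal.ofReal t < g x}, f x ∂μ := by
  have hm := measurable_indicator_ofReal_lt hg
  calc ∫⁻ x, f x * g x ^ p ∂μ
      = ∫⁻ x, (∫⁻ t in Set.Ioi (0 : ℝ), f x * (ENNReal.ofReal (p * t ^ (p - 1)) *
          {t | ENNReal.ofReal t < g x}.indicator 1 t)) ∂μ := by
        congr 1 with x
        rw [lintegral_const_mul, lintegral_Ioi_mul_indicator_ofReal_lt hp]
        exact .mul (by fun_prop) (hm.comp measurable_prodMk_left)
    _ = ∫⁻ t in Set.Ioi (0 : ℝ), ∫⁻ x, f x * (ENNReal.ofReal (p * t ^ (p - 1)) *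
          {t | ENNReal.ofReal t < g x}.indicator 1 t) ∂μ :=
        lintegral_lintegral_swap
          ((hf.comp measurable_fst).mul (.mul (by fun_prop) hm)).aemeasurable
    _ = ∫⁻ t in Set.Ioi (0 : ℝ), ENNReal.ofReal (p * t ^ (p - 1)) *
          ∫⁻ x in {x | ENNReal.ofReal t < g x}, f x ∂μ := by
        congr 1 with t
        have hs : MeasurableSet {x | ENNReal.ofReal t < g x} := measurableSet_lt measurable_const hg
        rw [← lintegral_indicator hs, ← lintegral_const_mul _ (hf.indicator hs)]
        congr 1 with x
        by_cases h : ENNReal.ofReal t < g x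
        · simp [Set.indicator, h, mul_comm]
        · simp [Set.indicator, h]

end LayerCake

section CenteredMaximal

/-- The centered maximal function of `g` with respect to the measure `μ`. Only closed balls of
rational radius enter, so that it is a countable supremum and hence measurable. -/
noncomputable def centeredMaximal {E : Type*} [PseudoMetricSpace E] [MeasurableSpace E]
    (μ : Measure E) (g : E → ℝ≥0∞) (x : E) : ℝ≥0∞ :=
  ⨆ r : {r : ℚ // 0 < r}, (μ (Metric.closedBall x r.1))⁻¹ *
    ∫⁻ y in Metric.closedBall x r.1, g y ∂μ

section PseudoMetricSpace

variable {E : Type*} [PseudoMetricSpace E] [MeasurableSpace E] (μ : Measure E) (g : E → ℝ≥0∞)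

theorem le_centeredMaximal (x : E) {r : ℚ} (hr : 0 < r) :
    (μ (Metric.closedBall x r))⁻¹ * ∫⁻ y in Metric.closedBall x r, g y ∂μ ≤
      centeredMaximal μ g x :=
  le_iSup (fun r : {r : ℚ // 0 < r} => (μ (Metric.closedBall x r.1))⁻¹ *
    ∫⁻ y in Metric.closedBall x r.1, g y ∂μ) ⟨r, hr⟩

theorem centeredMaximal_le_add (t : ℝ≥0∞) (x : E) :
    centeredMaximal μ g x ≤ centeredMaximal μ ({x | t < g x}.indicator g) x + t := by
  refine iSup_le fun r => ?_
  set B := Metric.closedBall x (r.1 : ℝ)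
  calc (μ B)⁻¹ * ∫⁻ y in B, g y ∂μ
      ≤ (μ B)⁻¹ * ∫⁻ y in B, ({x | t < g x}.indicator g y + t) ∂μ := by
        gcongr with y
        by_cases h : t < g y
        · simp [Set.indicator, h]
        · simpa [Set.indicator, h] using not_lt.1 h
    _ = (μ B)⁻¹ * ∫⁻ y in B, {x | t < g x}.indicator g y ∂μ + t * ((μ B)⁻¹ * μ B) := by
        rw [lintegral_add_right _ measurable_const, mul_add, setLIntegral_const]
        ring
    _ ≤ centeredMaximal μ ({x | t < g x}.indicator g) x + t := by
        gcongr
        · exact le_centeredMaximal _ _ _ r.2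
        · exact mul_le_of_le_one_right' (ENNReal.inv_mul_le_one _)

end PseudoMetricSpace

section Measurability

variable {E : Type*} [PseudoMetricSpace E] [SecondCountableTopology E] [MeasurableSpace E]
  [BorelSpace E] (μ : Measure E) [SFinite μ]

theorem measurable_setLIntegral_closedBall {g : E → ℝ≥0∞} (hg : Measurable g) (r : ℝ) :
    Measurable fun x => ∫⁻ y in Metric.closedBall x r, g y ∂μ := by
  have hs : MeasurableSet {z : E × E | dist z.2 z.1 ≤ r} :=
    measurableSet_le (by fun_prop) measurable_const
  convert ((hg.comp measurable_snd).indicator hs).lintegral_prod_right' (ν := μ) using 2 with x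
  rw [← lintegral_indicator Metric.isClosed_closedBall.measurableSet]
  rfl

theorem measurable_measure_closedBall (r : ℝ) :
    Measurable fun x => μ (Metric.closedBall x r) := by
  simpa using measurable_setLIntegral_closedBall μ measurable_one r

theorem measurable_centeredMaximal {g : E → ℝ≥0∞} (hg : Measurable g) :
    Measurable (centeredMaximal μ g) :=
  .iSup fun _ => (measurable_measure_closedBall μ _).inv.mul
    (measurable_setLIntegral_closedBall μ hg _)

end Measurability

theorem mul_measure_biUnion_le_lintegral {E ι : Type*} [MeasurableSpace E] {μ : Measure E}
    {g : E → ℝ≥0∞} {t : ℝ≥0∞} {s : Set ι} {B : ι → Set E} (hs : s.Countable)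
    (hB : ∀ j ∈ s, MeasurableSet (B j)) (hdisj : s.PairwiseDisjoint B)
    (h : ∀ j ∈ s, t * μ (B j) ≤ ∫⁻ y in B j, g y ∂μ) :
    t * μ (⋃ j ∈ s, B j) ≤ ∫⁻ y, g y ∂μ := by
  calc t * μ (⋃ j ∈ s, B j) = ∑' j : s, t * μ (B j) := by
        rw [measure_biUnion hs hdisj hB, ENNReal.tsum_mul_left]
    _ ≤ ∑' j : s, ∫⁻ y in B j, g y ∂μ := ENNReal.tsum_le_tsum fun j => h j j.2
    _ = ∫⁻ y in ⋃ j ∈ s, B j, g y ∂μ := (lintegral_biUnion hs hB hdisj _).symm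
    _ ≤ ∫⁻ y, g y ∂μ := setLIntegral_le_lintegral _ _

theorem mul_measure_closedBall_le {E : Type*} [PseudoMetricSpace E] [MeasurableSpace E]
    {μ : Measure E} {g : E → ℝ≥0∞} {t : ℝ≥0∞} {x : E} {r : ℝ}
    (h : t < (μ (Metric.closedBall x r))⁻¹ * ∫⁻ y in Metric.closedBall x r, g y ∂μ) :
    t * μ (Metric.closedBall x r) ≤ ∫⁻ y in Metric.closedBall x r, g y ∂μ := by
  rcases eq_or_ne (μ (Metric.closedBall x r)) 0 with h0 | h0
  · simp [h0]
  · have htop : μ (Metric.closedBall x r) ≠ ∞ := fun htop => by simp [htop] at h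
    rw [← ENNReal.div_eq_inv_mul] at h
    exact (ENNReal.le_div_iff_mul_le (.inl h0) (.inl htop)).1 h.le

section Besicovitch

variable (E : Type*) [MetricSpace E] [SecondCountableTopology E] [MeasurableSpace E]
  [BorelSpace E] [HasBesicovitchCovering E]

theorem exists_mul_measure_le_lintegral_of_closedBall :
    ∃ N : ℕ, ∀ (μ : Measure E) (g : E → ℝ≥0∞) (t : ℝ≥0∞) (A : Set E) (r : E → ℝ) (R : ℝ),
      (∀ x ∈ A, 0 < r x) → (∀ x ∈ A, r x ≤ R) →
      (∀ x ∈ A, t * μ (Metric.closedBall x (r x)) ≤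
        ∫⁻ y in Metric.closedBall x (r x), g y ∂μ) →
      t * μ A ≤ N * ∫⁻ y, g y ∂μ := by
  obtain ⟨N, τ, hτ, hN⟩ := HasBesicovitchCovering.no_satelliteConfig (α := E)
  refine ⟨N, fun μ g t A r R hpos hle hball => ?_⟩
  let q : Besicovitch.BallPackage A E :=
    { c := fun x => x
      r := fun x => r x
      rpos := fun x => hpos x x.2
      r_bound := R
      r_le := fun x => hle x x.2 }
  obtain ⟨s, hdisj, hcov⟩ := Besicovitch.exist_disjoint_covering_families hτ hN q
  have hcount (i) : (s i).Countable := (hdisj i).countable_of_nonempty_interior fun x _ =>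
    ⟨q.c x, Metric.ball_subset_interior_closedBall (Metric.mem_ball_self (q.rpos x))⟩
  have hfam (i) : t * μ (⋃ j ∈ s i, Metric.closedBall (q.c j) (q.r j)) ≤ ∫⁻ y, g y ∂μ :=
    mul_measure_biUnion_le_lintegral (hcount i)
      (fun _ _ => Metric.isClosed_closedBall.measurableSet) (hdisj i) fun x _ => hball x x.2
  have hA : A ⊆ ⋃ i, ⋃ j ∈ s i, Metric.closedBall (q.c j) (q.r j) := fun x hx =>
    Set.iUnion_mono (fun i => Set.iUnion₂_mono fun _ _ => Metric.ball_subset_closedBall)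
      (hcov ⟨⟨x, hx⟩, rfl⟩)
  calc t * μ A ≤ t * ∑ i, μ (⋃ j ∈ s i, Metric.closedBall (q.c j) (q.r j)) := by
        gcongr
        exact (measure_mono hA).trans (measure_iUnion_fintype_le μ _)
    _ = ∑ i, t * μ (⋃ j ∈ s i, Metric.closedBall (q.c j) (q.r j)) := Finset.mul_sum ..
    _ ≤ ∑ _i : Fin N, ∫⁻ y, g y ∂μ := Finset.sum_le_sum fun i _ => hfam i
    _ = N * ∫⁻ y, g y ∂μ := by simp

theorem exists_centeredMaximal_weakType :
    ∃ N : ℕ, ∀ (μ : Measure E) (g : E → ℝ≥0∞) (t : ℝ≥0∞),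
      t * μ {x | t < centeredMaximal μ g x} ≤ N * ∫⁻ y, g y ∂μ := by
  obtain ⟨N, hN⟩ := exists_mul_measure_le_lintegral_of_closedBall E
  refine ⟨N, fun μ g t => ?_⟩
  -- the covering theorem needs bounded radii
  let A : ℕ → Set E := fun R => {x | ∃ r : ℚ, 0 < r ∧ r ≤ R ∧
    t < (μ (Metric.closedBall x r))⁻¹ * ∫⁻ y in Metric.closedBall x r, g y ∂μ}
  have hA : {x | t < centeredMaximal μ g x} = ⋃ R, A R := by
    ext x
    simp only [Set.mem_ofPred_eq, centeredMaximal, lt_iSup_iff, Set.mem_iUnion, A]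
    constructor
    · rintro ⟨⟨r, hr⟩, h⟩
      obtain ⟨R, hR⟩ := exists_nat_ge r
      exact ⟨R, r, hr, hR, h⟩
    · rintro ⟨R, r, hr, -, h⟩
      exact ⟨⟨r, hr⟩, h⟩
  have hmono : Monotone A := by
    rintro R R' h x ⟨r, hr, hrR, hx⟩
    exact ⟨r, hr, hrR.trans (by exact_mod_cast h), hx⟩
  rw [hA, hmono.measure_iUnion, ENNReal.mul_iSup]
  refine iSup_le fun R => ?_
  choose! r hr0 hrR hr using fun x (hx : x ∈ A R) => hx
  exact hN μ g t (A R) (fun x => r x) R (fun x hx => by exact_mod_cast hr0 x hx)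
    (fun x hx => by exact_mod_cast hrR x hx) fun x hx => mul_measure_closedBall_le (hr x hx)

theorem exists_mul_measure_lt_centeredMaximal_le :
    ∃ N : ℕ, ∀ (μ : Measure E) {g : E → ℝ≥0∞} (_ : Measurable g) (t : ℝ≥0∞),
      t * μ {x | t < centeredMaximal μ g x} ≤ 2 * N * ∫⁻ x in {x | t < 2 * g x}, g x ∂μ := by
  obtain ⟨N, hN⟩ := exists_centeredMaximal_weakType E
  refine ⟨N, fun μ g hg t => ?_⟩
  have hset : {x | t < 2 * g x} = {x | t / 2 < g x} := by
    ext x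
    simp only [Set.mem_ofPred_eq]
    rw [ENNReal.div_lt_iff (.inl two_ne_zero) (.inl ENNReal.ofNat_ne_top), mul_comm]
  have hsub : {x | t < centeredMaximal μ g x} ⊆
      {x | t / 2 < centeredMaximal μ ({x | t / 2 < g x}.indicator g) x} := by
    intro x hx
    by_contra hcon
    have h := (centeredMaximal_le_add μ g (t / 2) x).trans (add_le_add_left (not_lt.1 hcon) _)
    rw [ENNReal.add_halves] at h
    exact absurd hx (not_lt.2 h)
  calc t * μ {x | t < centeredMaximal μ g x}
      ≤ t * μ {x | t / 2 < centeredMaximal μ ({x | t / 2 < g x}.indicator g) x} := by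
        gcongr
    _ = 2 * (t / 2 * μ {x | t / 2 < centeredMaximal μ ({x | t / 2 < g x}.indicator g) x}) := by
        rw [← mul_assoc, ENNReal.mul_div_cancel two_ne_zero ENNReal.ofNat_ne_top]
    _ ≤ 2 * (N * ∫⁻ x, {x | t / 2 < g x}.indicator g x ∂μ) := by
        gcongr 2 * ?_
        exact hN ..
    _ = 2 * N * ∫⁻ x in {x | t < 2 * g x}, g x ∂μ := by
        rw [hset, lintegral_indicator (measurableSet_lt measurable_const hg), mul_assoc]

theorem exists_centeredMaximal_strongType {p : ℝ} (hp : 1 < p) :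
    ∃ C : ℝ≥0, ∀ (μ : Measure E) [SFinite μ] {g : E → ℝ≥0∞}, Measurable g →
      ∫⁻ x, centeredMaximal μ g x ^ p ∂μ ≤ C * ∫⁻ x, g x ^ p ∂μ := by
  obtain ⟨N, hN⟩ := exists_mul_measure_lt_centeredMaximal_le E
  have hp1 : 0 < p - 1 := by linarith
  set c : ℝ≥0∞ := 2 * N * ENNReal.ofReal (p / (p - 1)) with hc
  have hctop : c ≠ ∞ := by finiteness
  refine ⟨(c * 2 ^ (p - 1)).toNNReal, fun μ _ g hg => ?_⟩
  rw [ENNReal.coe_toNNReal (by finiteness)]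
  calc ∫⁻ x, centeredMaximal μ g x ^ p ∂μ
      = ∫⁻ t in Set.Ioi (0 : ℝ), ENNReal.ofReal (p * t ^ (p - 1)) *
          μ {x | ENNReal.ofReal t < centeredMaximal μ g x} := by
        simpa using lintegral_mul_rpow_eq_lintegral_lt μ (f := 1) measurable_one
          (measurable_centeredMaximal μ hg) (p := p) (by linarith)
    _ ≤ ∫⁻ t in Set.Ioi (0 : ℝ), c * (ENNReal.ofReal ((p - 1) * t ^ (p - 1 - 1)) *
          ∫⁻ x in {x | ENNReal.ofReal t < 2 * g x}, g x ∂μ) := by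
        refine setLIntegral_mono' measurableSet_Ioi fun t ht => ?_
        rw [ofReal_mul_rpow_sub_one_eq hp ht, mul_assoc, mul_assoc]
        refine (mul_le_mul_right (mul_le_mul_right (hN μ hg (.ofReal t)) _) _).trans_eq ?_
        rw [hc]
        ring
    _ = c * ∫⁻ x, g x * (2 * g x) ^ (p - 1) ∂μ := by
        rw [lintegral_const_mul' _ _ hctop,
          lintegral_mul_rpow_eq_lintegral_lt μ hg (hg.const_mul 2) hp1]
    _ = c * ∫⁻ x, 2 ^ (p - 1) * g x ^ p ∂μ := by
        congr! 3 with x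
        rw [ENNReal.mul_rpow_of_nonneg _ _ hp1.le, mul_left_comm]
        nth_rw 1 [← ENNReal.rpow_one (g x)]
        rw [← ENNReal.rpow_add_of_nonneg _ _ zero_le_one hp1.le, add_sub_cancel]
    _ = c * 2 ^ (p - 1) * ∫⁻ x, g x ^ p ∂μ := by
        rw [lintegral_const_mul' _ _ (by finiteness), ← mul_assoc]

end Besicovitch

end CenteredMaximal

section ENNReal

variable {ι : Type*} [Fintype ι] {a : ℝ≥0∞} {b : ι → ℝ≥0∞} {e : ι → ℝ}

theorem prod_rpow_mul_prod_rpow {c : ι → ℝ} (h0 : ∀ i, b i ≠ 0) (htop : ∀ i, b i ≠ ∞) :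
    (∏ i, b i ^ e i) * ∏ i, b i ^ c i = ∏ i, b i ^ (e i + c i) := by
  rw [← Finset.prod_mul_distrib]
  exact Finset.prod_congr rfl fun i _ => (ENNReal.rpow_add _ _ (h0 i) (htop i)).symm

theorem ne_zero_of_mul_prod_rpow_ne_zero (he : ∀ i, 0 < e i) (h : a * ∏ i, b i ^ e i ≠ 0) :
    a ≠ 0 ∧ ∀ i, b i ≠ 0 := by
  refine ⟨left_ne_zero_of_mul h, fun i hi => right_ne_zero_of_mul h ?_⟩
  exact Finset.prod_eq_zero (Finset.mem_univ i) (by rw [hi, ENNReal.zero_rpow_of_pos (he i)])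

theorem ne_top_of_mul_prod_rpow_ne_top (he : ∀ i, 0 < e i) (ha : a ≠ 0) (hb : ∀ i, b i ≠ 0)
    (h : a * ∏ i, b i ^ e i ≠ ∞) : a ≠ ∞ ∧ ∀ i, b i ≠ ∞ := by
  classical
  have hprod (s : Finset ι) : ∏ i ∈ s, b i ^ e i ≠ 0 :=
    Finset.prod_ne_zero_iff.2 fun i _ => mt (ENNReal.rpow_eq_zero_iff_of_pos (he i)).1 (hb i)
  refine ⟨(ENNReal.lt_top_of_mul_ne_top_left h (hprod _)).ne, fun i hi => ?_⟩
  have hne : ∏ i, b i ^ e i ≠ ∞ := (ENNReal.lt_top_of_mul_ne_top_right h ha).ne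
  rw [← Finset.mul_prod_erase _ _ (Finset.mem_univ i), hi, ENNReal.top_rpow_of_pos (he i),
    ENNReal.top_mul (hprod _)] at hne
  exact hne rfl

end ENNReal

section Holder

variable {E : Type*} [MeasurableSpace E] (μ : Measure E)

theorem setLIntegral_le_lintegral_rpow_mul_measure_rpow {g : E → ℝ≥0∞} (hg : AEMeasurable g μ)
    {P : ℝ} (hP : 1 ≤ P) (s : Set E) :
    ∫⁻ x in s, g x ∂μ ≤ (∫⁻ x, g x ^ P ∂μ) ^ (1 / P) * μ s ^ (1 - 1 / P) := by
  have hP0 : 0 < P := by linarith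
  have hP1 : 1 / P ≤ 1 := (div_le_one hP0).2 hP
  have h := ENNReal.lintegral_mul_norm_pow_le (μ := μ.restrict s) (f := fun x => g x ^ P)
    (g := fun _ => 1) (hg.pow_const P).restrict aemeasurable_const (p := 1 / P)
    (q := 1 - 1 / P) (by positivity) (by linarith) (by ring)
  simp only [ENNReal.one_rpow, mul_one, lintegral_const, Measure.restrict_apply_univ, one_mul,
    ← ENNReal.rpow_mul, mul_one_div_cancel hP0.ne', ENNReal.rpow_one] at h
  exact h.trans (by gcongr; exact Measure.restrict_le_self)

-- interpolates between Hölder's inequality (`r = 1 / P`) and the trivial identity (`r = 0`)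
theorem setLIntegral_le_lintegral_rpow_mul_average_rpow {g : E → ℝ≥0∞} (hg : AEMeasurable g μ)
    {P r : ℝ} (hP : 1 ≤ P) (hr : 0 ≤ r) (hrP : r ≤ 1 / P) {Q Q' : Set E}
    (hQ : Q ⊆ Q') (h0 : μ Q' ≠ 0) (htop : μ Q' ≠ ∞) :
    ∫⁻ x in Q, g x ∂μ ≤ (∫⁻ x, g x ^ P ∂μ) ^ r * μ Q' ^ (1 - r) *
      ((μ Q')⁻¹ * ∫⁻ x in Q, g x ∂μ) ^ (1 - r * P) := by
  have hP0 : 0 < P := by linarith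
  have hrP' : 0 ≤ 1 - r * P := sub_nonneg.2 ((le_div_iff₀ hP0).1 hrP)
  have hP1 : 0 ≤ 1 - 1 / P := sub_nonneg.2 ((div_le_one hP0).2 hP)
  set I := ∫⁻ x in Q, g x ∂μ
  set W := ∫⁻ x, g x ^ P ∂μ
  have hI : I ≤ W ^ (1 / P) * μ Q' ^ (1 - 1 / P) :=
    (setLIntegral_le_lintegral_rpow_mul_measure_rpow μ hg hP Q).trans (by gcongr)
  calc I = I ^ (r * P) * (μ Q' * ((μ Q')⁻¹ * I)) ^ (1 - r * P) := by
        rw [← mul_assoc, ENNReal.mul_inv_cancel h0 htop, one_mul,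
          ← ENNReal.rpow_add_of_nonneg _ _ (by positivity) hrP', add_sub_cancel, ENNReal.rpow_one]
    _ ≤ (W ^ (1 / P) * μ Q' ^ (1 - 1 / P)) ^ (r * P) *
          (μ Q' * ((μ Q')⁻¹ * I)) ^ (1 - r * P) := by gcongr
    _ = W ^ r * μ Q' ^ (1 - r) * ((μ Q')⁻¹ * I) ^ (1 - r * P) := by
        rw [ENNReal.mul_rpow_of_nonneg _ _ (by positivity), ENNReal.mul_rpow_of_nonneg _ _ hrP',
          ← ENNReal.rpow_mul, ← ENNReal.rpow_mul, ← mul_assoc, mul_assoc (_ ^ (1 / P * (r * P))),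
          ← ENNReal.rpow_add _ _ h0 htop]
        congr 3
        · field_simp
        · field_simp
          ring

variable {μ}

theorem measure_univ_rpow_mul_le_of_ae_le {ι : Type*} [Fintype ι] {g : E → ℝ≥0∞}
    {f : ι → E → ℝ≥0∞} (hg : AEMeasurable g μ) (hf : ∀ i, AEMeasurable (f i) μ) {a e : ℝ}
    {b : ι → ℝ} (ha : 0 ≤ a) (hb : ∀ i, 0 ≤ b i) (he : 0 < e) (hsum : a + ∑ i, b i = e)
    {h : ℝ≥0∞} (hle : ∀ᵐ x ∂μ, h ≤ g x ^ a * ∏ i, f i x ^ b i) :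
    μ Set.univ ^ e * h ≤ (∫⁻ x, g x ∂μ) ^ a * ∏ i, (∫⁻ x, f i x ∂μ) ^ b i := by
  have hroot (x : ℝ≥0∞) (y : ι → ℝ≥0∞) :
      (x ^ (a / e) * ∏ i, y i ^ (b i / e)) = (x ^ a * ∏ i, y i ^ b i) ^ (1 / e) := by
    rw [ENNReal.mul_rpow_of_nonneg _ _ (by positivity),
      ← ENNReal.prod_rpow_of_nonneg (by positivity)]
    simp only [← ENNReal.rpow_mul, mul_one_div]
  have hholder := ENNReal.lintegral_mul_prod_norm_pow_le (μ := μ) Finset.univ hg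
    (fun i _ => hf i) (a / e) (p := fun i => b i / e)
    (by rw [← Finset.sum_div, ← add_div, hsum, div_self he.ne']) (by positivity)
    fun i _ => div_nonneg (hb i) he.le
  simp only [hroot] at hholder
  have hconst : h ^ (1 / e) * μ Set.univ ≤
      ((∫⁻ x, g x ∂μ) ^ a * ∏ i, (∫⁻ x, f i x ∂μ) ^ b i) ^ (1 / e) := by
    rw [← lintegral_const]
    refine (lintegral_mono_ae ?_).trans hholder
    filter_upwards [hle] with x hx
    gcongr
  calc μ Set.univ ^ e * h = (h ^ (1 / e) * μ Set.univ) ^ e := by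
        rw [ENNReal.mul_rpow_of_nonneg _ _ he.le, ← ENNReal.rpow_mul,
          one_div_mul_cancel he.ne', ENNReal.rpow_one, mul_comm]
    _ ≤ (((∫⁻ x, g x ∂μ) ^ a * ∏ i, (∫⁻ x, f i x ∂μ) ^ b i) ^ (1 / e)) ^ e := by gcongr
    _ = (∫⁻ x, g x ∂μ) ^ a * ∏ i, (∫⁻ x, f i x ∂μ) ^ b i := by
        rw [← ENNReal.rpow_mul, one_div_mul_cancel he.ne', ENNReal.rpow_one]

end Holder

section Cube

variable {n : ℕ}

theorem cube_eq_Icc (a : Fin n → ℝ) (ℓ : ℝ) : cube a ℓ = Set.Icc a (fun j => a j + ℓ) := by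
  ext x
  simp [cube, Pi.le_def, forall_and]

theorem measurableSet_cube (a : Fin n → ℝ) (ℓ : ℝ) : MeasurableSet (cube a ℓ) :=
  cube_eq_Icc a ℓ ▸ measurableSet_Icc

theorem volume_cube (a : Fin n → ℝ) (ℓ : ℝ) : volume (cube a ℓ) = ENNReal.ofReal ℓ ^ n := by
  rw [cube_eq_Icc, Real.volume_Icc_pi]
  simp

theorem volume_cube_ne_zero (a : Fin n → ℝ) {ℓ : ℝ} (hℓ : 0 < ℓ) : volume (cube a ℓ) ≠ 0 := by
  rw [volume_cube]
  exact pow_ne_zero _ (by simpa using hℓ)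

theorem volume_cube_ne_top (a : Fin n → ℝ) (ℓ : ℝ) : volume (cube a ℓ) ≠ ∞ := by
  rw [volume_cube]
  exact ENNReal.pow_ne_top ENNReal.ofReal_ne_top

/-- The cube concentric with `cube a ℓ` of side length `5 * ℓ`: it contains every ball of radius
at most `2 * ℓ` centred in `cube a ℓ`. -/
def enlargedCube (a : Fin n → ℝ) (ℓ : ℝ) : Set (Fin n → ℝ) :=
  cube (fun j => a j - 2 * ℓ) (5 * ℓ)

theorem volume_enlargedCube (a : Fin n → ℝ) (ℓ : ℝ) :
    volume (enlargedCube a ℓ) = 5 ^ n * volume (cube a ℓ) := by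
  rw [enlargedCube, volume_cube, volume_cube, ENNReal.ofReal_mul (by norm_num), mul_pow,
    ENNReal.ofReal_ofNat]

theorem cube_subset_enlargedCube (a : Fin n → ℝ) {ℓ : ℝ} (hℓ : 0 ≤ ℓ) :
    cube a ℓ ⊆ enlargedCube a ℓ := fun y hy j => by
  have := hy j
  constructor <;> linarith

theorem cube_subset_closedBall {a y : Fin n → ℝ} {ℓ r : ℝ} (hy : y ∈ cube a ℓ) (hℓ : 0 ≤ ℓ)
    (hr : ℓ ≤ r) : cube a ℓ ⊆ Metric.closedBall y r := by
  intro x hx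
  rw [Metric.mem_closedBall, dist_pi_le_iff (hℓ.trans hr)]
  intro j
  rw [Real.dist_eq, abs_le]
  have := hx j
  have := hy j
  constructor <;> linarith

theorem closedBall_subset_enlargedCube {a y : Fin n → ℝ} {ℓ r : ℝ} (hy : y ∈ cube a ℓ)
    (hr0 : 0 ≤ r) (hr : r ≤ 2 * ℓ) : Metric.closedBall y r ⊆ enlargedCube a ℓ := by
  intro x hx j
  rw [Metric.mem_closedBall, dist_pi_le_iff hr0] at hx
  have h := hx j
  rw [Real.dist_eq, abs_le] at h
  have := hy j
  constructor <;> linarith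

theorem inv_measure_enlargedCube_mul_setLIntegral_le (μ : Measure (Fin n → ℝ))
    (g : (Fin n → ℝ) → ℝ≥0∞) {a y : Fin n → ℝ} {ℓ : ℝ} (hℓ : 0 < ℓ) (hy : y ∈ cube a ℓ) :
    (μ (enlargedCube a ℓ))⁻¹ * ∫⁻ x in cube a ℓ, g x ∂μ ≤ centeredMaximal μ g y := by
  obtain ⟨r, hr1, hr2⟩ := exists_rat_btwn (show ℓ < 2 * ℓ by linarith)
  have hr0 : (0 : ℝ) < r := hℓ.trans hr1
  refine le_trans ?_ (le_centeredMaximal μ g y (r := r) (by exact_mod_cast hr0))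
  gcongr
  · exact closedBall_subset_enlargedCube hy hr0.le hr2.le
  · exact cube_subset_closedBall hy hℓ.le hr1.le

theorem cube_neg_eq_closedBall {ℓ : ℝ} (hℓ : 0 ≤ ℓ) :
    cube (fun _ : Fin n => -ℓ) (2 * ℓ) = Metric.closedBall 0 ℓ := by
  ext x
  simp only [cube, Set.mem_ofPred_eq, Metric.mem_closedBall, dist_zero_right,
    pi_norm_le_iff_of_nonneg hℓ, Real.norm_eq_abs, abs_le]
  refine forall_congr' fun j => and_congr_right fun _ => ?_
  rw [show -ℓ + 2 * ℓ = ℓ by ring]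

end Cube

/-! ### Splitting the order -/

section DualSystem

variable {ι : Type*} [Fintype ι] {P : ι → ℝ} {q κ : ℝ} {r : ι → ℝ}

/-- A splitting of the fractional order among the `m` factors: `r i` is the order assigned to the
`i`-th factor, and `κ` is the resulting power of `[ω]` in the bound for `‖M_α f‖_{L^q} ^ q`. -/
structure OrderSplitting (P : ι → ℝ) (q κ : ℝ) (r : ι → ℝ) : Prop where
  one_lt : ∀ i, 1 < P i
  q_pos : 0 < q
  one_lt_κ : 1 < κ
  nonneg : ∀ i, 0 ≤ r i
  lt : ∀ i, r i < 1 / P i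
  le : ∀ i, 1 - κ * (1 - 1 / P i) ≤ r i
  sum_sub : ∑ i, (1 / P i - r i) = 1 / q

/-- The exponent `1 / q + ∑ᵢ 1 / Pᵢ'`, which equals `m - α / n` in the setting of the theorem. -/
noncomputable def totalExponent (P : ι → ℝ) (q : ℝ) : ℝ :=
  1 / q + ∑ i, (1 - 1 / P i)

/-- Densities `σ i` and `v` that are dual to each other in the sense that
`v ^ (1 / q) * ∏ᵢ σᵢ ^ (1 / Pᵢ') = 1`. For a multiple weight these are `ωᵢ ^ (-Pᵢ')` and
`ν_ω ^ q`. -/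
structure IsDualSystem {E : Type*} [MeasurableSpace E] (μ : Measure E) (P : ι → ℝ) (q : ℝ)
    (σ : ι → E → ℝ≥0∞) (v : E → ℝ≥0∞) : Prop where
  measurable_left : ∀ i, Measurable (σ i)
  measurable_right : Measurable v
  ae_mul_eq_one : ∀ᵐ x ∂μ, v x ^ (1 / q) * ∏ i, σ i x ^ (1 - 1 / P i) = 1

theorem one_sub_one_div_pos {p : ℝ} (hp : 1 < p) : 0 < 1 - 1 / p :=
  sub_pos.2 ((div_lt_one (by linarith)).2 hp)

namespace OrderSplitting

theorem one_sub_mul_pos (D : OrderSplitting P q κ r) (i : ι) : 0 < 1 - r i * P i :=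
  sub_pos.2 ((lt_div_iff₀ (by linarith [D.one_lt i])).1 (D.lt i))

theorem holder_exponent_nonneg (D : OrderSplitting P q κ r) (i : ι) :
    0 ≤ r i - 1 + κ * (1 - 1 / P i) := by
  linarith [D.le i]

theorem mul_sub_nonneg (D : OrderSplitting P q κ r) (i : ι) : 0 ≤ q * (1 / P i - r i) :=
  mul_nonneg D.q_pos.le (by linarith [D.lt i])

theorem prod_rpow_mul_prod_rpow (D : OrderSplitting P q κ r) (W : ι → ℝ≥0∞) :
    (∏ i, W i ^ (r i * q)) * ∏ i, W i ^ (q * (1 / P i - r i)) = ∏ i, W i ^ (q / P i) := by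
  rw [← Finset.prod_mul_distrib]
  refine Finset.prod_congr rfl fun i _ => ?_
  rw [← ENNReal.rpow_add_of_nonneg _ _ (mul_nonneg (D.nonneg i) D.q_pos.le) (D.mul_sub_nonneg i)]
  ring_nf

theorem totalExponent_pos (D : OrderSplitting P q κ r) : 0 < totalExponent P q :=
  add_pos_of_pos_of_nonneg (one_div_pos.2 D.q_pos)
    (Finset.sum_nonneg fun i _ => (one_sub_one_div_pos (D.one_lt i)).le)

theorem sum_mul_sub (D : OrderSplitting P q κ r) : ∑ i, q * (1 / P i - r i) = 1 := by
  rw [← Finset.mul_sum, D.sum_sub, mul_one_div_cancel D.q_pos.ne']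

theorem sum_holder_exponents (D : OrderSplitting P q κ r) :
    κ / q + ∑ i, (r i - 1 + κ * (1 - 1 / P i)) = totalExponent P q * (κ - 1) := by
  have h (i) : r i - 1 + κ * (1 - 1 / P i) =
      (κ - 1) * (1 - 1 / P i) - (1 / P i - r i) := by ring
  simp only [h, Finset.sum_sub_distrib (fun i => (κ - 1) * (1 - 1 / P i)), D.sum_sub,
    ← Finset.mul_sum, totalExponent]
  ring

end OrderSplitting

namespace IsDualSystem

variable {E : Type*} [MeasurableSpace E] {μ : Measure E} {σ : ι → E → ℝ≥0∞} {v : E → ℝ≥0∞}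

theorem ae_ne_zero (h : IsDualSystem μ P q σ v) (hP : ∀ i, 1 < P i) (hq : 0 < q) :
    ∀ᵐ x ∂μ, v x ≠ 0 ∧ ∀ i, σ i x ≠ 0 := by
  filter_upwards [h.ae_mul_eq_one] with x hx
  have := ne_zero_of_mul_prod_rpow_ne_zero (fun i => one_sub_one_div_pos (hP i))
    (hx ▸ one_ne_zero)
  exact ⟨mt (ENNReal.rpow_eq_zero_iff_of_pos (one_div_pos.2 hq)).2 this.1, this.2⟩

theorem ae_right_ne_top (h : IsDualSystem μ P q σ v) (hP : ∀ i, 1 < P i) (hq : 0 < q) :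
    ∀ᵐ x ∂μ, v x ≠ ∞ := by
  filter_upwards [h.ae_mul_eq_one, h.ae_ne_zero hP hq] with x hx h0
  have hq' : 0 < 1 / q := one_div_pos.2 hq
  have hv := (ne_top_of_mul_prod_rpow_ne_top (fun i => one_sub_one_div_pos (hP i))
    (mt (ENNReal.rpow_eq_zero_iff_of_pos hq').1 h0.1) h0.2 (hx ▸ ENNReal.one_ne_top)).1
  exact mt (ENNReal.rpow_eq_top_iff_of_pos hq').2 hv

end IsDualSystem

section AuxDensity

variable {E : Type*}

/-- The density to which Hölder's inequality reduces the multilinear averages; `H` stands for a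
product of powers of maximal functions of the factors. -/
noncomputable def auxDensity (P : ι → ℝ) (q κ : ℝ) (r : ι → ℝ) (σ : ι → E → ℝ≥0∞)
    (v H : E → ℝ≥0∞) (x : E) : ℝ≥0∞ :=
  (H x * v x ^ ((κ - 1) / q) * ∏ i, σ i x ^ (1 / P i - r i)) ^ (q / κ)

theorem auxDensity_rpow_mul_prod_rpow (D : OrderSplitting P q κ r) {σ : ι → E → ℝ≥0∞}
    {v H : E → ℝ≥0∞} {x : E} (hx : v x ^ (1 / q) * ∏ i, σ i x ^ (1 - 1 / P i) = 1) :
    auxDensity P q κ r σ v H x ^ (κ / q) * ∏ i, σ i x ^ (r i - 1 + κ * (1 - 1 / P i)) = H x := by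
  have hκ : 0 < κ - 1 := sub_pos.2 D.one_lt_κ
  have hq := D.q_pos
  have hσ (i) : σ i x ^ (1 / P i - r i) * σ i x ^ (r i - 1 + κ * (1 - 1 / P i)) =
      (σ i x ^ (1 - 1 / P i)) ^ (κ - 1) := by
    rw [← ENNReal.rpow_add_of_nonneg _ _ (by linarith [D.lt i]) (D.holder_exponent_nonneg i),
      ← ENNReal.rpow_mul]
    ring_nf
  have hv : v x ^ ((κ - 1) / q) = (v x ^ (1 / q)) ^ (κ - 1) := by
    rw [← ENNReal.rpow_mul]
    ring_nf
  have hexp : q / κ * (κ / q) = 1 := by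
    have : 0 < κ := by linarith
    field_simp
  rw [auxDensity, ← ENNReal.rpow_mul, hexp, ENNReal.rpow_one, mul_assoc,
    ← Finset.prod_mul_distrib, Finset.prod_congr rfl fun i _ => hσ i,
    ENNReal.prod_rpow_of_nonneg hκ.le, hv, mul_assoc, ← ENNReal.mul_rpow_of_nonneg _ _ hκ.le, hx,
    ENNReal.one_rpow, mul_one]

theorem mul_inv_mul_auxDensity_rpow (D : OrderSplitting P q κ r) {σ G : ι → E → ℝ≥0∞}
    {v : E → ℝ≥0∞} {x : E} (h0 : v x ≠ 0) (htop : v x ≠ ∞) :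
    v x * ((v x)⁻¹ * auxDensity P q κ r σ v (fun x => ∏ i, G i x ^ (1 - r i * P i)) x) ^ κ =
      ∏ i, (σ i x * G i x ^ P i) ^ (q * (1 / P i - r i)) := by
  have hq := D.q_pos
  have hκ : 0 < κ := by linarith [D.one_lt_κ]
  have hfactor (i) : (G i x ^ (1 - r i * P i) * σ i x ^ (1 / P i - r i)) ^ q =
      (σ i x * G i x ^ P i) ^ (q * (1 / P i - r i)) := by
    have hP : 0 < P i := by linarith [D.one_lt i]
    have hr : 0 ≤ 1 / P i - r i := by linarith [D.lt i]
    rw [mul_comm, mul_comm q, ENNReal.rpow_mul, ENNReal.mul_rpow_of_nonneg _ _ hr,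
      ← ENNReal.rpow_mul (G i x)]
    congr 3
    field_simp
  have haux : auxDensity P q κ r σ v (fun x => ∏ i, G i x ^ (1 - r i * P i)) x ^ κ =
      v x ^ (κ - 1) * ∏ i, (σ i x * G i x ^ P i) ^ (q * (1 / P i - r i)) := by
    rw [auxDensity, ← ENNReal.rpow_mul, div_mul_cancel₀ _ hκ.ne', mul_right_comm,
      ENNReal.mul_rpow_of_nonneg _ _ hq.le, mul_comm, ← ENNReal.rpow_mul, div_mul_cancel₀ _ hq.ne',
      ← Finset.prod_mul_distrib, ← ENNReal.prod_rpow_of_nonneg hq.le]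
    simp only [hfactor]
  have hv : v x * v x ^ (-κ) * v x ^ (κ - 1) = 1 := by
    nth_rw 1 [← ENNReal.rpow_one (v x)]
    rw [← ENNReal.rpow_add _ _ h0 htop, ← ENNReal.rpow_add _ _ h0 htop]
    ring_nf
    simp
  rw [ENNReal.mul_rpow_of_nonneg _ _ hκ.le, haux, ← mul_assoc, ← mul_assoc, ENNReal.inv_rpow,
    ← ENNReal.rpow_neg, hv, one_mul]

variable [MeasurableSpace E] {μ : Measure E} {σ : ι → E → ℝ≥0∞} {v : E → ℝ≥0∞}

theorem measurable_auxDensity {H : E → ℝ≥0∞} (hσ : ∀ i, Measurable (σ i)) (hv : Measurable v)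
    (hH : Measurable H) : Measurable (auxDensity P q κ r σ v H) :=
  ((hH.mul (hv.pow_const _)).mul
    (Finset.measurable_prod _ fun i _ => (hσ i).pow_const _)).pow_const _

theorem measure_univ_rpow_mul_le_lintegral_auxDensity (D : OrderSplitting P q κ r)
    (hσv : IsDualSystem μ P q σ v) {H : E → ℝ≥0∞} (hH : Measurable H) {h : ℝ≥0∞}
    (hle : ∀ᵐ x ∂μ, h ≤ H x) :
    μ Set.univ ^ (totalExponent P q * (κ - 1)) * h ≤
      (∫⁻ x, auxDensity P q κ r σ v H x ∂μ) ^ (κ / q) *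
        ∏ i, (∫⁻ x, σ i x ∂μ) ^ (r i - 1 + κ * (1 - 1 / P i)) := by
  have hκ := D.one_lt_κ
  refine measure_univ_rpow_mul_le_of_ae_le
    (measurable_auxDensity hσv.measurable_left hσv.measurable_right hH).aemeasurable
    (fun i => (hσv.measurable_left i).aemeasurable) (div_nonneg (by linarith) D.q_pos.le)
    D.holder_exponent_nonneg (mul_pos D.totalExponent_pos (by linarith)) D.sum_holder_exponents ?_
  filter_upwards [hle, hσv.ae_mul_eq_one] with x hx hone
  rwa [auxDensity_rpow_mul_prod_rpow D hone]

theorem lintegral_inv_mul_auxDensity_rpow_le (D : OrderSplitting P q κ r)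
    (hσv : IsDualSystem μ P q σ v) {G : ι → E → ℝ≥0∞} (hG : ∀ i, Measurable (G i)) :
    ∫⁻ x, ((v x)⁻¹ * auxDensity P q κ r σ v (fun x => ∏ i, G i x ^ (1 - r i * P i)) x) ^ κ
        ∂(μ.withDensity v) ≤
      ∏ i, (∫⁻ x, G i x ^ P i ∂(μ.withDensity (σ i))) ^ (q * (1 / P i - r i)) := by
  have hσ := hσv.measurable_left
  have hv := hσv.measurable_right
  have hF : Measurable fun x => (v x)⁻¹ *
      auxDensity P q κ r σ v (fun x => ∏ i, G i x ^ (1 - r i * P i)) x :=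
    hv.inv.mul (measurable_auxDensity hσ hv
      (Finset.measurable_prod _ fun i _ => (hG i).pow_const _))
  rw [lintegral_withDensity_eq_lintegral_mul _ hv (hF.pow_const _)]
  calc ∫⁻ x, v x * ((v x)⁻¹ *
          auxDensity P q κ r σ v (fun x => ∏ i, G i x ^ (1 - r i * P i)) x) ^ κ ∂μ
      = ∫⁻ x, ∏ i, (σ i x * G i x ^ P i) ^ (q * (1 / P i - r i)) ∂μ := by
        refine lintegral_congr_ae ?_
        filter_upwards [hσv.ae_ne_zero D.one_lt D.q_pos, hσv.ae_right_ne_top D.one_lt D.q_pos]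
          with x h0 htop
        exact mul_inv_mul_auxDensity_rpow D h0.1 htop
    _ ≤ ∏ i, (∫⁻ x, σ i x * G i x ^ P i ∂μ) ^ (q * (1 / P i - r i)) :=
        ENNReal.lintegral_prod_norm_pow_le Finset.univ
          (fun i _ => ((hσ i).mul ((hG i).pow_const _)).aemeasurable) D.sum_mul_sub
          fun i _ => D.mul_sub_nonneg i
    _ = ∏ i, (∫⁻ x, G i x ^ P i ∂(μ.withDensity (σ i))) ^ (q * (1 / P i - r i)) := by
        refine Finset.prod_congr rfl fun i _ => ?_
        rw [lintegral_withDensity_eq_lintegral_mul _ (hσ i) ((hG i).pow_const _)]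
        rfl

end AuxDensity

end DualSystem

section MuckenhouptSystem

/-- A dual system on `ℝⁿ` whose `A_{(P,q)}` constant is at most `K`, where the averages in the
constant are multiplied out. -/
structure IsMuckenhouptSystem {n : ℕ} {ι : Type*} [Fintype ι] (P : ι → ℝ) (q : ℝ)
    (σ : ι → (Fin n → ℝ) → ℝ≥0∞) (v : (Fin n → ℝ) → ℝ≥0∞) (K : ℝ≥0∞) : Prop
    extends IsDualSystem volume P q σ v where
  ne_top : K ≠ ∞
  cube_le : ∀ (a : Fin n → ℝ) {ℓ : ℝ}, 0 < ℓ →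
    volume.withDensity v (cube a ℓ) *
        ∏ i, volume.withDensity (σ i) (cube a ℓ) ^ (q * (1 - 1 / P i)) ≤
      K * volume (cube a ℓ) ^ (q * totalExponent P q)

/-- The multilinear fractional maximal operator with respect to the measures `μ i`; the exponent
`s` plays the role of `m - α / n`. -/
noncomputable def measureFracMaximal {n : ℕ} {ι : Type*} [Fintype ι] (s : ℝ)
    (μ : ι → Measure (Fin n → ℝ)) (g : ι → (Fin n → ℝ) → ℝ≥0∞) (x : Fin n → ℝ) : ℝ≥0∞ :=
  ⨆ (a : Fin n → ℝ) (ℓ : ℝ) (_ : 0 < ℓ) (_ : x ∈ cube a ℓ),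
    volume (cube a ℓ) ^ (-s) * ∏ i, ∫⁻ y in cube a ℓ, g i y ∂(μ i)

/-- The function whose centered maximal function with respect to `v dx` dominates
`measureFracMaximal`. -/
noncomputable def majorant {n : ℕ} {ι : Type*} [Fintype ι] (P : ι → ℝ) (q κ : ℝ) (r : ι → ℝ)
    (σ : ι → (Fin n → ℝ) → ℝ≥0∞) (v : (Fin n → ℝ) → ℝ≥0∞) (g : ι → (Fin n → ℝ) → ℝ≥0∞)
    (x : Fin n → ℝ) : ℝ≥0∞ :=
  (v x)⁻¹ * auxDensity P q κ r σ v
    (fun y => ∏ i, centeredMaximal (volume.withDensity (σ i)) (g i) y ^ (1 - r i * P i)) x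

theorem withDensity_cube_ne_zero {n : ℕ} {f : (Fin n → ℝ) → ℝ≥0∞} (hf : Measurable f)
    (h0 : ∀ᵐ x, f x ≠ 0) (a : Fin n → ℝ) {ℓ : ℝ} (hℓ : 0 < ℓ) :
    volume.withDensity f (cube a ℓ) ≠ 0 := fun h =>
  volume_cube_ne_zero a hℓ (withDensity_absolutelyContinuous' hf.aemeasurable h0 h)

variable {n : ℕ} {ι : Type*} [Fintype ι] {P : ι → ℝ} {q κ : ℝ} {r : ι → ℝ}
  {σ g : ι → (Fin n → ℝ) → ℝ≥0∞} {v : (Fin n → ℝ) → ℝ≥0∞} {K : ℝ≥0∞}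

theorem measurable_prod_centeredMaximal_rpow (hg : ∀ i, Measurable (g i)) :
    Measurable fun y => ∏ i,
      centeredMaximal (volume.withDensity (σ i)) (g i) y ^ (1 - r i * P i) :=
  Finset.measurable_prod _ fun i _ => (measurable_centeredMaximal _ (hg i)).pow_const _

theorem measurable_majorant (hσ : ∀ i, Measurable (σ i)) (hv : Measurable v)
    (hg : ∀ i, Measurable (g i)) : Measurable (majorant P q κ r σ v g) :=
  hv.inv.mul (measurable_auxDensity hσ hv (measurable_prod_centeredMaximal_rpow hg))

namespace IsMuckenhouptSystem

theorem cube_ne_zero (S : IsMuckenhouptSystem P q σ v K) (hP : ∀ i, 1 < P i) (hq : 0 < q)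
    (a : Fin n → ℝ) {ℓ : ℝ} (hℓ : 0 < ℓ) :
    volume.withDensity v (cube a ℓ) ≠ 0 ∧ ∀ i, volume.withDensity (σ i) (cube a ℓ) ≠ 0 := by
  have h0 := S.ae_ne_zero hP hq
  exact ⟨withDensity_cube_ne_zero S.measurable_right (h0.mono fun _ h => h.1) a hℓ, fun i =>
    withDensity_cube_ne_zero (S.measurable_left i) (h0.mono fun _ h => h.2 i) a hℓ⟩

theorem cube_ne_top (S : IsMuckenhouptSystem P q σ v K) (hP : ∀ i, 1 < P i) (hq : 0 < q)
    (a : Fin n → ℝ) {ℓ : ℝ} (hℓ : 0 < ℓ) :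
    volume.withDensity v (cube a ℓ) ≠ ∞ ∧ ∀ i, volume.withDensity (σ i) (cube a ℓ) ≠ ∞ := by
  have h0 := S.cube_ne_zero hP hq a hℓ
  refine ne_top_of_mul_prod_rpow_ne_top (fun i => mul_pos hq (one_sub_one_div_pos (hP i))) h0.1
    h0.2 (ne_top_of_le_ne_top (ENNReal.mul_ne_top S.ne_top ?_) (S.cube_le a hℓ))
  exact ENNReal.rpow_ne_top_of_ne_zero (volume_cube_ne_zero a hℓ) (volume_cube_ne_top a ℓ)

theorem prod_rpow_mul_rpow_le (S : IsMuckenhouptSystem P q σ v K) (hq : 0 < q) (hκ : 0 ≤ κ)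
    (hs : 0 ≤ totalExponent P q) (a : Fin n → ℝ) {ℓ : ℝ} (hℓ : 0 < ℓ) :
    (∏ i, volume.withDensity (σ i) (enlargedCube a ℓ) ^ (κ * (1 - 1 / P i))) *
        volume.withDensity v (enlargedCube a ℓ) ^ (κ / q) ≤
      K ^ (κ / q) * ((5 ^ n) ^ (totalExponent P q * κ) *
        volume (cube a ℓ) ^ (totalExponent P q * κ)) := by
  have hκq : 0 ≤ κ / q := div_nonneg hκ hq.le
  have hle := ENNReal.rpow_le_rpow
    (S.cube_le (fun j => a j - 2 * ℓ) (by positivity : 0 < 5 * ℓ)) hκq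
  have hexp (x : ℝ) : q * x * (κ / q) = x * κ := by field_simp
  rw [ENNReal.mul_rpow_of_nonneg _ _ hκq, ENNReal.mul_rpow_of_nonneg _ _ hκq,
    ← ENNReal.prod_rpow_of_nonneg hκq] at hle
  simp only [← ENNReal.rpow_mul, hexp] at hle
  rw [← enlargedCube] at hle
  rw [← ENNReal.mul_rpow_of_nonneg _ _ (mul_nonneg hs hκ), ← volume_enlargedCube, mul_comm]
  simpa only [mul_comm κ] using hle

end IsMuckenhouptSystem

section Domination

variable (D : OrderSplitting P q κ r) (S : IsMuckenhouptSystem P q σ v K)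
  (hg : ∀ i, Measurable (g i)) {a : Fin n → ℝ} {ℓ : ℝ} (hℓ : 0 < ℓ)

include D S hg hℓ

theorem prod_setLIntegral_cube_le :
    ∏ i, ∫⁻ y in cube a ℓ, g i y ∂(volume.withDensity (σ i)) ≤
      (∏ i, (∫⁻ y, g i y ^ P i ∂(volume.withDensity (σ i))) ^ r i) *
        (∏ i, volume.withDensity (σ i) (enlargedCube a ℓ) ^ (1 - r i)) *
        ∏ i, ((volume.withDensity (σ i) (enlargedCube a ℓ))⁻¹ *
          ∫⁻ y in cube a ℓ, g i y ∂(volume.withDensity (σ i))) ^ (1 - r i * P i) := by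
  rw [← Finset.prod_mul_distrib, ← Finset.prod_mul_distrib]
  have h5 : 0 < 5 * ℓ := by positivity
  exact Finset.prod_le_prod' fun i _ => setLIntegral_le_lintegral_rpow_mul_average_rpow _
    (hg i).aemeasurable (D.one_lt i).le (D.nonneg i) (D.lt i).le
    (cube_subset_enlargedCube a hℓ.le) ((S.cube_ne_zero D.one_lt D.q_pos _ h5).2 i)
    ((S.cube_ne_top D.one_lt D.q_pos _ h5).2 i)

omit hg in
theorem setLIntegral_auxDensity_cube_le {H : (Fin n → ℝ) → ℝ≥0∞} (hH : Measurable H)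
    {x : Fin n → ℝ} (hx : x ∈ cube a ℓ) :
    ∫⁻ y in cube a ℓ, auxDensity P q κ r σ v H y ≤
      volume.withDensity v (enlargedCube a ℓ) * centeredMaximal (volume.withDensity v)
        (fun y => (v y)⁻¹ * auxDensity P q κ r σ v H y) x := by
  have hv := S.measurable_right
  have h5 : 0 < 5 * ℓ := by positivity
  have haux := measurable_auxDensity (P := P) (q := q) (κ := κ) (r := r) S.measurable_left hv hH
  calc ∫⁻ y in cube a ℓ, auxDensity P q κ r σ v H y
      = ∫⁻ y in cube a ℓ, v y * ((v y)⁻¹ * auxDensity P q κ r σ v H y) := by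
        refine lintegral_congr_ae (ae_restrict_of_ae ?_)
        filter_upwards [S.ae_ne_zero D.one_lt D.q_pos, S.ae_right_ne_top D.one_lt D.q_pos]
          with y h0 htop
        rw [← mul_assoc, ENNReal.mul_inv_cancel h0.1 htop, one_mul]
    _ = ∫⁻ y in cube a ℓ, (v y)⁻¹ * auxDensity P q κ r σ v H y ∂(volume.withDensity v) :=
        (setLIntegral_withDensity_eq_setLIntegral_mul _ hv (hv.inv.mul haux)
          (measurableSet_cube a ℓ)).symm
    _ = volume.withDensity v (enlargedCube a ℓ) * ((volume.withDensity v (enlargedCube a ℓ))⁻¹ *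
          ∫⁻ y in cube a ℓ, (v y)⁻¹ * auxDensity P q κ r σ v H y ∂(volume.withDensity v)) := by
        rw [← mul_assoc, enlargedCube, ENNReal.mul_inv_cancel
          (S.cube_ne_zero D.one_lt D.q_pos _ h5).1 (S.cube_ne_top D.one_lt D.q_pos _ h5).1, one_mul]
    _ ≤ _ := by
        gcongr
        exact inv_measure_enlargedCube_mul_setLIntegral_le _ _ hℓ hx

theorem volume_cube_rpow_mul_prod_average_le {x : Fin n → ℝ} (hx : x ∈ cube a ℓ) :
    volume (cube a ℓ) ^ (totalExponent P q * (κ - 1)) *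
        ∏ i, ((volume.withDensity (σ i) (enlargedCube a ℓ))⁻¹ *
          ∫⁻ y in cube a ℓ, g i y ∂(volume.withDensity (σ i))) ^ (1 - r i * P i) ≤
      (volume.withDensity v (enlargedCube a ℓ) *
          centeredMaximal (volume.withDensity v) (majorant P q κ r σ v g) x) ^ (κ / q) *
        ∏ i, volume.withDensity (σ i) (enlargedCube a ℓ) ^ (r i - 1 + κ * (1 - 1 / P i)) := by
  have hH := measurable_prod_centeredMaximal_rpow (P := P) (r := r) (σ := σ) hg
  have hrestrict : IsDualSystem (volume.restrict (cube a ℓ)) P q σ v :=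
    ⟨S.measurable_left, S.measurable_right, ae_restrict_of_ae S.ae_mul_eq_one⟩
  have hholder := measure_univ_rpow_mul_le_lintegral_auxDensity D hrestrict hH
    (h := ∏ i, ((volume.withDensity (σ i) (enlargedCube a ℓ))⁻¹ *
      ∫⁻ y in cube a ℓ, g i y ∂(volume.withDensity (σ i))) ^ (1 - r i * P i)) <| by
    filter_upwards [ae_restrict_mem (measurableSet_cube a ℓ)] with y hy
    exact Finset.prod_le_prod' fun i _ => ENNReal.rpow_le_rpow
      (inv_measure_enlargedCube_mul_setLIntegral_le _ (g i) hℓ hy) (D.one_sub_mul_pos i).le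
  rw [Measure.restrict_apply_univ] at hholder
  refine hholder.trans ?_
  gcongr with i
  · exact div_nonneg (by linarith [D.one_lt_κ]) D.q_pos.le
  · exact setLIntegral_auxDensity_cube_le D S hℓ hH hx
  · exact D.holder_exponent_nonneg i
  · rw [← withDensity_apply _ (measurableSet_cube a ℓ)]
    exact measure_mono (cube_subset_enlargedCube a hℓ.le)

omit hℓ in
theorem measureFracMaximal_le (x : Fin n → ℝ) :
    measureFracMaximal (totalExponent P q) (fun i => volume.withDensity (σ i)) g x ≤
      (5 ^ n) ^ (totalExponent P q * κ) * K ^ (κ / q) *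
        (∏ i, (∫⁻ y, g i y ^ P i ∂(volume.withDensity (σ i))) ^ r i) *
        centeredMaximal (volume.withDensity v) (majorant P q κ r σ v g) x ^ (κ / q) := by
  refine iSup₂_le fun a ℓ => iSup₂_le fun hℓ hx => ?_
  have hq := D.q_pos
  have hs := D.totalExponent_pos
  have hκ : 0 < κ := by linarith [D.one_lt_κ]
  have h5 : 0 < 5 * ℓ := by positivity
  set s := totalExponent P q
  set L := volume (cube a ℓ)
  have hL0 : L ≠ 0 := volume_cube_ne_zero a hℓ
  have hLtop : L ≠ ∞ := volume_cube_ne_top a ℓ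
  set μ : ι → ℝ≥0∞ := fun i => volume.withDensity (σ i) (enlargedCube a ℓ)
  have hμ0 : ∀ i, μ i ≠ 0 := (S.cube_ne_zero D.one_lt hq _ h5).2
  have hμtop : ∀ i, μ i ≠ ∞ := (S.cube_ne_top D.one_lt hq _ h5).2
  set ν := volume.withDensity v (enlargedCube a ℓ)
  set M := centeredMaximal (volume.withDensity v) (majorant P q κ r σ v g) x
  set W := ∏ i, (∫⁻ y, g i y ^ P i ∂(volume.withDensity (σ i))) ^ r i
  set A := ∏ i, ((μ i)⁻¹ * ∫⁻ y in cube a ℓ, g i y ∂(volume.withDensity (σ i))) ^ (1 - r i * P i)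
  have hμexp : (∏ i, μ i ^ (1 - r i)) * ∏ i, μ i ^ (r i - 1 + κ * (1 - 1 / P i)) =
      ∏ i, μ i ^ (κ * (1 - 1 / P i)) := by
    rw [prod_rpow_mul_prod_rpow hμ0 hμtop]
    ring_nf
  calc L ^ (-s) * ∏ i, ∫⁻ y in cube a ℓ, g i y ∂(volume.withDensity (σ i))
      ≤ L ^ (-s) * (W * (∏ i, μ i ^ (1 - r i)) * A) := by
        gcongr
        exact prod_setLIntegral_cube_le D S hg hℓ
    _ = W * L ^ (-(s * κ)) * (∏ i, μ i ^ (1 - r i)) * (L ^ (s * (κ - 1)) * A) := by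
        rw [show -s = -(s * κ) + s * (κ - 1) by ring, ENNReal.rpow_add _ _ hL0 hLtop]
        ring
    _ ≤ W * L ^ (-(s * κ)) * (∏ i, μ i ^ (1 - r i)) *
          ((ν * M) ^ (κ / q) * ∏ i, μ i ^ (r i - 1 + κ * (1 - 1 / P i))) :=
        mul_le_mul_right (volume_cube_rpow_mul_prod_average_le D S hg hℓ hx) _
    _ = W * L ^ (-(s * κ)) * ((∏ i, μ i ^ (κ * (1 - 1 / P i))) * ν ^ (κ / q)) * M ^ (κ / q) := by
        rw [← hμexp, ENNReal.mul_rpow_of_nonneg _ _ (by positivity)]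
        ring
    _ ≤ W * L ^ (-(s * κ)) * (K ^ (κ / q) * ((5 ^ n) ^ (s * κ) * L ^ (s * κ))) * M ^ (κ / q) := by
        gcongr ?_ * _
        exact mul_le_mul_right (S.prod_rpow_mul_rpow_le hq hκ.le hs.le a hℓ) _
    _ = (L ^ (-(s * κ)) * L ^ (s * κ)) * ((5 ^ n) ^ (s * κ) * K ^ (κ / q) * W * M ^ (κ / q)) := by
        ring
    _ = (5 ^ n) ^ (s * κ) * K ^ (κ / q) * W * M ^ (κ / q) := by
        rw [← ENNReal.rpow_add _ _ hL0 hLtop, neg_add_cancel, ENNReal.rpow_zero, one_mul]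

end Domination

theorem exists_lintegral_majorant_rpow_le (n : ℕ) (D : OrderSplitting P q κ r) :
    ∃ C : ℝ≥0, ∀ (σ g : ι → (Fin n → ℝ) → ℝ≥0∞) (v : (Fin n → ℝ) → ℝ≥0∞),
      IsDualSystem volume P q σ v → (∀ i, Measurable (g i)) →
      ∫⁻ x, majorant P q κ r σ v g x ^ κ ∂(volume.withDensity v) ≤
        C * ∏ i, (∫⁻ y, g i y ^ P i ∂(volume.withDensity (σ i))) ^ (q * (1 / P i - r i)) := by
  choose C hC using fun i => exists_centeredMaximal_strongType (Fin n → ℝ) (D.one_lt i)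
  refine ⟨∏ i, C i ^ (q * (1 / P i - r i)), fun σ g v S hg => ?_⟩
  rw [ENNReal.ofNNReal_finsetProd, ← Finset.prod_mul_distrib]
  refine (lintegral_inv_mul_auxDensity_rpow_le D S
    fun i => measurable_centeredMaximal (volume.withDensity (σ i)) (hg i)).trans ?_
  refine Finset.prod_le_prod' fun i _ => ?_
  rw [ENNReal.coe_rpow_of_nonneg _ (D.mul_sub_nonneg i),
    ← ENNReal.mul_rpow_of_nonneg _ _ (D.mul_sub_nonneg i)]
  exact ENNReal.rpow_le_rpow (hC i _ (hg i)) (D.mul_sub_nonneg i)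

theorem exists_lintegral_measureFracMaximal_rpow_le (n : ℕ) (D : OrderSplitting P q κ r) :
    ∃ C : ℝ≥0, ∀ (σ g : ι → (Fin n → ℝ) → ℝ≥0∞) (v : (Fin n → ℝ) → ℝ≥0∞) (K : ℝ≥0∞),
      IsMuckenhouptSystem P q σ v K → (∀ i, Measurable (g i)) →
      ∫⁻ x, measureFracMaximal (totalExponent P q) (fun i => volume.withDensity (σ i)) g x ^ q
          ∂(volume.withDensity v) ≤
        C * K ^ κ * ∏ i, (∫⁻ y, g i y ^ P i ∂(volume.withDensity (σ i))) ^ (q / P i) := by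
  have hq := D.q_pos
  have hs := D.totalExponent_pos
  have hκ : 0 < κ := by linarith [D.one_lt_κ]
  obtain ⟨C₀, hC₀⟩ := exists_centeredMaximal_strongType (Fin n → ℝ) D.one_lt_κ
  obtain ⟨C₁, hC₁⟩ := exists_lintegral_majorant_rpow_le n D
  refine ⟨(5 ^ n) ^ (totalExponent P q * κ * q) * C₀ * C₁, fun σ g v K S hg => ?_⟩
  set F := majorant P q κ r σ v g
  have hF : Measurable F := measurable_majorant S.measurable_left S.measurable_right hg
  set ν := volume.withDensity v
  set W : ι → ℝ≥0∞ := fun i => ∫⁻ y, g i y ^ P i ∂(volume.withDensity (σ i))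
  set B := (5 ^ n) ^ (totalExponent P q * κ) * K ^ (κ / q) * ∏ i, W i ^ r i with hB
  have hBq : B ^ q = (5 ^ n) ^ (totalExponent P q * κ * q) * K ^ κ * ∏ i, W i ^ (r i * q) := by
    rw [hB, ENNReal.mul_rpow_of_nonneg _ _ hq.le, ENNReal.mul_rpow_of_nonneg _ _ hq.le,
      ← ENNReal.rpow_mul, ← ENNReal.rpow_mul, div_mul_cancel₀ _ hq.ne',
      ← ENNReal.prod_rpow_of_nonneg hq.le]
    simp_rw [← ENNReal.rpow_mul]
  calc ∫⁻ x, measureFracMaximal (totalExponent P q) (fun i => volume.withDensity (σ i)) g x ^ q ∂ν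
      ≤ ∫⁻ x, B ^ q * centeredMaximal ν F x ^ κ ∂ν := by
        refine lintegral_mono fun x => ?_
        refine (ENNReal.rpow_le_rpow (measureFracMaximal_le D S hg x) hq.le).trans_eq ?_
        rw [ENNReal.mul_rpow_of_nonneg _ _ hq.le, ← ENNReal.rpow_mul, div_mul_cancel₀ _ hq.ne']
    _ = B ^ q * ∫⁻ x, centeredMaximal ν F x ^ κ ∂ν :=
        lintegral_const_mul _ ((measurable_centeredMaximal ν hF).pow_const _)
    _ ≤ B ^ q * (C₀ * (C₁ * ∏ i, W i ^ (q * (1 / P i - r i)))) := by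
        gcongr
        exact (hC₀ ν hF).trans (mul_le_mul_right (hC₁ σ g v S.toIsDualSystem hg) _)
    _ = _ := by
        rw [hBq, ← D.prod_rpow_mul_prod_rpow W]
        push_cast
        rw [ENNReal.coe_rpow_of_nonneg _ (by positivity)]
        push_cast
        ring

end MuckenhouptSystem

theorem inv_conjExponent_eq_one_sub {p : ℝ} (hp : 1 < p) : p.conjExponent⁻¹ = 1 - 1 / p := by
  rw [Real.conjExponent, inv_div, sub_div, div_self (by linarith)]

theorem conjExponent_pos {p : ℝ} (hp : 1 < p) : 0 < p.conjExponent :=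
  (Real.HolderConjugate.conjExponent hp).symm.pos

section Exponents

variable {ι : Type*} [Fintype ι] {P : ι → ℝ} {q β : ℝ}

theorem totalExponent_eq (hq : 1 / q = ∑ i, 1 / P i - β) :
    totalExponent P q = Fintype.card ι - β := by
  rw [totalExponent, hq, Finset.sum_sub_distrib, Finset.sum_const, Finset.card_univ,
    nsmul_eq_mul, mul_one]
  ring

theorem exists_between_sum_eq {b c : ι → ℝ} (hbc : ∀ i, b i < c i) {A : ℝ}
    (hb : ∑ i, b i ≤ A) (hc : A < ∑ i, c i) :
    ∃ r : ι → ℝ, (∀ i, b i ≤ r i) ∧ (∀ i, r i < c i) ∧ ∑ i, r i = A := by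
  have hd : 0 < ∑ i, c i - ∑ i, b i := by linarith
  set t := (A - ∑ i, b i) / (∑ i, c i - ∑ i, b i) with ht
  have ht0 : 0 ≤ t := div_nonneg (by linarith) hd.le
  have ht1 : t < 1 := (div_lt_one hd).2 (by linarith)
  refine ⟨fun i => b i + t * (c i - b i), fun i => ?_, fun i => ?_, ?_⟩
  · linarith [mul_nonneg ht0 (sub_nonneg.2 (hbc i).le)]
  · linarith [mul_lt_mul_of_pos_right ht1 (sub_pos.2 (hbc i))]
  · rw [Finset.sum_add_distrib, ← Finset.mul_sum, Finset.sum_sub_distrib, ht,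
      div_mul_cancel₀ _ hd.ne']
    ring

theorem one_le_iSup_conjExponent_mul {ι : Type*} [Finite ι] {P : ι → ℝ} (hP : ∀ i, 1 < P i)
    (i : ι) :
    1 ≤ (⨆ j, (P j).conjExponent) * (1 - 1 / P i) := by
  rw [← inv_conjExponent_eq_one_sub (hP i), ← div_eq_mul_inv, one_le_div (conjExponent_pos (hP i))]
  exact le_ciSup (f := fun j => (P j).conjExponent) (Set.finite_range _).bddAbove i

theorem one_lt_mul_iSup_conjExponent [Nonempty ι] (hP : ∀ i, 1 < P i)
    (hβP : β < ∑ i, 1 / P i) :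
    1 < (1 - β / Fintype.card ι) * ⨆ i, (P i).conjExponent := by
  set M := ⨆ i, (P i).conjExponent
  have hm : (0 : ℝ) < Fintype.card ι := by exact_mod_cast Fintype.card_pos
  have hM : 0 < M := pos_of_mul_pos_left
    (one_pos.trans_le (one_le_iSup_conjExponent_mul hP (Classical.arbitrary ι)))
    (one_sub_one_div_pos (hP _)).le
  have hsum : (Fintype.card ι : ℝ) ≤ M * (Fintype.card ι - ∑ i, 1 / P i) := by
    have h := Finset.card_nsmul_le_sum Finset.univ _ _
      fun i _ => one_le_iSup_conjExponent_mul hP i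
    rw [← Finset.mul_sum, Finset.sum_sub_distrib] at h
    simpa using h
  refine lt_of_mul_lt_mul_left ?_ hm.le
  calc (Fintype.card ι : ℝ) * 1 ≤ M * (Fintype.card ι - ∑ i, 1 / P i) := by rwa [mul_one]
    _ < M * (Fintype.card ι - β) := by gcongr
    _ = Fintype.card ι * ((1 - β / Fintype.card ι) * M) := by field_simp

theorem exists_orderSplitting (hP : ∀ i, 1 < P i) (hβ : 0 ≤ β) (hβP : β < ∑ i, 1 / P i)
    (hq : 1 / q = ∑ i, 1 / P i - β) :
    ∃ r, OrderSplitting P q ((1 - β / Fintype.card ι) * ⨆ i, (P i).conjExponent) r := by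
  have : Nonempty ι := by
    by_contra h
    rw [not_nonempty_iff] at h
    simp only [Finset.univ_eq_empty, Finset.sum_empty] at hβP
    exact hβP.not_ge hβ
  have hm : (0 : ℝ) < Fintype.card ι := by exact_mod_cast Fintype.card_pos
  have hq0 : 0 < q := one_div_pos.1 (by rw [hq]; linarith)
  have hκ := one_lt_mul_iSup_conjExponent hP hβP
  set M := ⨆ i, (P i).conjExponent
  set θ := 1 - β / Fintype.card ι
  have hθ0 : 0 ≤ θ := by
    have hPm : ∑ i, 1 / P i ≤ Fintype.card ι := by
      simpa using Finset.sum_le_card_nsmul Finset.univ _ 1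
        fun i _ => (sub_pos.1 (one_sub_one_div_pos (hP i))).le
    exact sub_nonneg.2 ((div_le_one hm).2 (hβP.le.trans hPm))
  have hlower (i) : max 0 (1 - θ * M * (1 - 1 / P i)) ≤ β / Fintype.card ι := by
    refine max_le (by positivity) ?_
    linarith [mul_le_mul_of_nonneg_left (one_le_iSup_conjExponent_mul hP i) hθ0]
  have hbc (i) : max 0 (1 - θ * M * (1 - 1 / P i)) < 1 / P i := by
    refine max_lt (one_div_pos.2 (by linarith [hP i])) ?_
    linarith [mul_lt_mul_of_pos_right hκ (one_sub_one_div_pos (hP i))]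
  have hsum : ∑ i, max 0 (1 - θ * M * (1 - 1 / P i)) ≤ β := by
    refine (Finset.sum_le_card_nsmul Finset.univ _ _ fun i _ => hlower i).trans_eq ?_
    rw [Finset.card_univ, nsmul_eq_mul, mul_div_cancel₀ _ hm.ne']
  obtain ⟨r, hr_ge, hr_lt, hr_sum⟩ := exists_between_sum_eq hbc hsum hβP
  exact ⟨r, hP, hq0, hκ, fun i => (le_max_left _ _).trans (hr_ge i), hr_lt,
    fun i => (le_max_right _ _).trans (hr_ge i), by rw [Finset.sum_sub_distrib, hr_sum, hq]⟩

end Exponents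

/-! ### The upper bound -/

section MultipleWeights

variable {n m : ℕ}

theorem prod_rpow_eq_rpow_sum {ι : Type*} (s : Finset ι) {x : ℝ≥0∞} (h0 : x ≠ 0) (htop : x ≠ ∞)
    (f : ι → ℝ) : ∏ i ∈ s, x ^ f i = x ^ ∑ i ∈ s, f i := by
  induction s using Finset.cons_induction with
  | empty => simp
  | cons i s hi ih => rw [Finset.prod_cons, Finset.sum_cons, ih, ENNReal.rpow_add _ _ h0 htop]

theorem eLpNorm_ofReal_eq_lintegral_rpow {X ε : Type*} [MeasurableSpace X] [ENorm ε] (f : X → ε)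
    (μ : Measure X) {q : ℝ} (hq : 0 < q) :
    eLpNorm f (ENNReal.ofReal q) μ = (∫⁻ x, ‖f x‖ₑ ^ q ∂μ) ^ (1 / q) := by
  rw [eLpNorm_eq_lintegral_rpow_enorm_toReal (by simpa using hq) ENNReal.ofReal_ne_top,
    ENNReal.toReal_ofReal hq.le]

/-- The dual weight `ω ^ (-p')`, with value `∞` where `ω = 0`. -/
noncomputable def dualWeight (p : ℝ) (w : (Fin n → ℝ) → ℝ≥0) (x : Fin n → ℝ) : ℝ≥0∞ :=
  (w x : ℝ≥0∞) ^ (-p.conjExponent)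

section Congruence

variable {ω ω' : Fin m → (Fin n → ℝ) → ℝ≥0} (h : ∀ i, ω i =ᵐ[volume] ω' i)

include h

theorem withDensity_prodWeight_congr_ae (q : ℝ) :
    (volume.withDensity fun x => prodWeight ω x ^ q) =
      volume.withDensity fun x => prodWeight ω' x ^ q := by
  refine withDensity_congr_ae ?_
  filter_upwards [ae_all_iff.2 h] with x hx
  simp only [prodWeight, hx]

theorem weightConst_congr_ae (P : Fin m → ℝ) (q : ℝ) :
    weightConst P q ω = weightConst P q ω' := by
  have hleft (a : Fin n → ℝ) (ℓ : ℝ) : ⨍⁻ x in cube a ℓ, prodWeight ω x ^ q ∂volume =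
      ⨍⁻ x in cube a ℓ, prodWeight ω' x ^ q ∂volume :=
    laverage_congr <| ae_restrict_of_ae <| by
      filter_upwards [ae_all_iff.2 h] with x hx
      simp only [prodWeight, hx]
  have hright (i) (a : Fin n → ℝ) (ℓ : ℝ) :
      ⨍⁻ x in cube a ℓ, (ω i x : ℝ≥0∞) ^ (-(P i).conjExponent) ∂volume =
        ⨍⁻ x in cube a ℓ, (ω' i x : ℝ≥0∞) ^ (-(P i).conjExponent) ∂volume :=
    laverage_congr <| ae_restrict_of_ae <| by filter_upwards [h i] with x hx; rw [hx]
  simp only [weightConst, hleft, hright]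

end Congruence

theorem fracMaximal_congr_ae (α : ℝ) {f f' : Fin m → (Fin n → ℝ) → ℂ}
    (h : ∀ i, f i =ᵐ[volume] f' i) : fracMaximal α f = fracMaximal α f' := by
  have hint (i) (a : Fin n → ℝ) (ℓ : ℝ) :
      ∫⁻ y in cube a ℓ, ‖f i y‖ₑ = ∫⁻ y in cube a ℓ, ‖f' i y‖ₑ :=
    lintegral_congr_ae <| ae_restrict_of_ae <| by filter_upwards [h i] with y hy; rw [hy]
  ext x
  simp only [fracMaximal, hint]

theorem eLpNorm_weight_congr_ae {w w' : (Fin n → ℝ) → ℝ≥0} (hw : w =ᵐ[volume] w')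
    {f f' : (Fin n → ℝ) → ℂ} (hf : f =ᵐ[volume] f') (p : ℝ) (s : ℝ≥0∞) :
    eLpNorm f s (volume.withDensity fun x => (w x : ℝ≥0∞) ^ p) =
      eLpNorm f' s (volume.withDensity fun x => (w' x : ℝ≥0∞) ^ p) := by
  have hμ : (volume.withDensity fun x => (w x : ℝ≥0∞) ^ p) =
      volume.withDensity fun x => (w' x : ℝ≥0∞) ^ p :=
    withDensity_congr_ae <| by filter_upwards [hw] with x hx; rw [hx]
  rw [hμ]
  exact eLpNorm_congr_ae ((withDensity_absolutelyContinuous volume _).ae_eq hf)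

theorem le_weightConst (P : Fin m → ℝ) (q : ℝ) (ω : Fin m → (Fin n → ℝ) → ℝ≥0)
    (a : Fin n → ℝ) {ℓ : ℝ} (hℓ : 0 < ℓ) :
    (⨍⁻ x in cube a ℓ, prodWeight ω x ^ q ∂volume) *
      ∏ i, (⨍⁻ x in cube a ℓ, (ω i x : ℝ≥0∞) ^ (-(P i).conjExponent) ∂volume) ^
        (q / (P i).conjExponent) ≤ weightConst P q ω :=
  le_iSup_of_le a (le_iSup_of_le ℓ (le_iSup_of_le hℓ le_rfl))

theorem prod_rpow_inv_mul_eq (hm : 0 < m) (hn : 0 < n) (α : ℝ) {L : ℝ≥0∞} (h0 : L ≠ 0)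
    (htop : L ≠ ∞) (I : Fin m → ℝ≥0∞) :
    ∏ i, (L ^ (1 - α / ((m : ℝ) * n)))⁻¹ * I i = L ^ (-(m - α / n)) * ∏ i, I i := by
  have hn' : (n : ℝ) ≠ 0 := by exact_mod_cast hn.ne'
  have hm' : (m : ℝ) ≠ 0 := by exact_mod_cast hm.ne'
  simp only [← ENNReal.rpow_neg]
  rw [Finset.prod_mul_distrib, prod_rpow_eq_rpow_sum _ h0 htop, Finset.sum_const,
    Finset.card_univ, Fintype.card_fin, nsmul_eq_mul]
  congr 2
  field_simp

section Weights

variable {P : Fin m → ℝ} {q α : ℝ} {ω : Fin m → (Fin n → ℝ) → ℝ≥0} {f : Fin m → (Fin n → ℝ) → ℂ}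

theorem measurable_prodWeight (hω : ∀ i, Measurable (ω i)) : Measurable (prodWeight ω) :=
  Finset.measurable_prod _ fun i _ => (hω i).coe_nnreal_ennreal

theorem measurable_dualWeight {w : (Fin n → ℝ) → ℝ≥0} (hw : Measurable w) (p : ℝ) :
    Measurable (dualWeight p w) :=
  hw.coe_nnreal_ennreal.pow_const _

theorem dualWeight_ne_zero {p : ℝ} (hp : 1 < p) (w : (Fin n → ℝ) → ℝ≥0) (x : Fin n → ℝ) :
    dualWeight p w x ≠ 0 := by
  rw [dualWeight, ENNReal.rpow_neg]
  exact ENNReal.inv_ne_zero.2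
    (ENNReal.rpow_ne_top_of_nonneg (conjExponent_pos hp).le ENNReal.coe_ne_top)

theorem withDensity_mul_prod_le_weightConst (hP : ∀ i, 1 < P i) (hq : 0 < q)
    (ω : Fin m → (Fin n → ℝ) → ℝ≥0) (a : Fin n → ℝ) {ℓ : ℝ} (hℓ : 0 < ℓ) :
    volume.withDensity (fun x => prodWeight ω x ^ q) (cube a ℓ) *
        ∏ i, volume.withDensity (dualWeight (P i) (ω i)) (cube a ℓ) ^ (q * (1 - 1 / P i)) ≤
      weightConst P q ω * volume (cube a ℓ) ^ (q * totalExponent P q) := by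
  have hL0 := volume_cube_ne_zero a hℓ
  have hLtop := volume_cube_ne_top a ℓ
  have hle := le_weightConst P q ω a hℓ
  simp only [setLAverage_eq, div_eq_mul_inv q, inv_conjExponent_eq_one_sub (hP _)] at hle
  simp only [withDensity_apply _ (measurableSet_cube a ℓ), dualWeight]
  set L := volume (cube a ℓ)
  have hLpow : L ^ (q * totalExponent P q) = L * ∏ i, L ^ (q * (1 - 1 / P i)) := by
    rw [prod_rpow_eq_rpow_sum _ hL0 hLtop, ← Finset.mul_sum, totalExponent, mul_add,
      mul_one_div_cancel hq.ne', ENNReal.rpow_add _ _ hL0 hLtop, ENNReal.rpow_one]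
  refine le_trans (le_of_eq ?_) (mul_le_mul_left hle _)
  rw [hLpow, mul_mul_mul_comm, ENNReal.div_mul_cancel hL0 hLtop, ← Finset.prod_mul_distrib]
  congr 1
  refine Finset.prod_congr rfl fun i _ => ?_
  rw [← ENNReal.mul_rpow_of_nonneg _ _ (mul_nonneg hq.le (one_sub_one_div_pos (hP i)).le),
    ENNReal.div_mul_cancel hL0 hLtop]

theorem withDensity_dualWeight_cube_ne_top (hP : ∀ i, 1 < P i) (hq : 0 < q)
    (hω : ∀ i, Measurable (ω i)) (hK : weightConst P q ω ≠ ∞) {a : Fin n → ℝ} {ℓ : ℝ}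
    (hℓ : 0 < ℓ) (h0 : volume.withDensity (fun x => prodWeight ω x ^ q) (cube a ℓ) ≠ 0)
    (i : Fin m) : volume.withDensity (dualWeight (P i) (ω i)) (cube a ℓ) ≠ ∞ := by
  refine (ne_top_of_mul_prod_rpow_ne_top (fun j => mul_pos hq (one_sub_one_div_pos (hP j))) h0
    (fun j => withDensity_cube_ne_zero (measurable_dualWeight (hω j) _)
      (.of_forall (dualWeight_ne_zero (hP j) (ω j))) a hℓ) (ne_top_of_le_ne_top ?_
        (withDensity_mul_prod_le_weightConst hP hq ω a hℓ))).2 i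
  exact ENNReal.mul_ne_top hK
    (ENNReal.rpow_ne_top_of_ne_zero (volume_cube_ne_zero a hℓ) (volume_cube_ne_top a ℓ))

theorem ae_weight_ne_zero (hP : ∀ i, 1 < P i) (hq : 0 < q) (hω : ∀ i, Measurable (ω i))
    (hK : weightConst P q ω ≠ ∞) (hν : volume.withDensity (fun x => prodWeight ω x ^ q) ≠ 0) :
    ∀ᵐ x, ∀ i, ω i x ≠ 0 := by
  obtain ⟨N, hN⟩ := exists_pos_ball (0 : Fin n → ℝ) hν
  have hball (i : Fin m) (k : ℕ) : ∀ᵐ x, x ∈ Metric.closedBall 0 (k : ℝ) → ω i x ≠ 0 := by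
    set R : ℝ := k + N + 1
    have hR : 0 < R := by positivity
    have hνR : volume.withDensity (fun x => prodWeight ω x ^ q)
        (cube (fun _ => -R) (2 * R)) ≠ 0 := by
      rw [cube_neg_eq_closedBall hR.le]
      refine (hN.trans_le (measure_mono (Metric.ball_subset_closedBall.trans
        (Metric.closedBall_subset_closedBall ?_)))).ne'
      linarith [k.cast_nonneg (α := ℝ)]
    have hfin := withDensity_dualWeight_cube_ne_top hP hq hω hK (by positivity) hνR i
    rw [cube_neg_eq_closedBall hR.le, withDensity_apply _ measurableSet_closedBall] at hfin
    filter_upwards [(ae_restrict_iff' measurableSet_closedBall).1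
      (ae_lt_top (measurable_dualWeight (hω i) _) hfin)] with x hx hxk h0
    refine (hx (Metric.closedBall_subset_closedBall ?_ hxk)).ne ?_
    · linarith [N.cast_nonneg (α := ℝ)]
    · rw [dualWeight, h0, ENNReal.coe_zero,
        ENNReal.zero_rpow_of_neg (neg_neg_of_pos (conjExponent_pos (hP i)))]
  refine ae_all_iff.2 fun i => ?_
  filter_upwards [ae_all_iff.2 (hball i)] with x hx
  obtain ⟨k, hk⟩ := exists_nat_ge ‖x‖
  exact hx k (mem_closedBall_zero_iff.2 hk)

theorem isMuckenhouptSystem_dualWeight (hP : ∀ i, 1 < P i) (hq : 0 < q)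
    (hω : ∀ i, Measurable (ω i)) (hK : weightConst P q ω ≠ ∞) (h0 : ∀ᵐ x, ∀ i, ω i x ≠ 0) :
    IsMuckenhouptSystem P q (fun i => dualWeight (P i) (ω i)) (fun x => prodWeight ω x ^ q)
      (weightConst P q ω) where
  measurable_left i := measurable_dualWeight (hω i) _
  measurable_right := (measurable_prodWeight hω).pow_const q
  ae_mul_eq_one := by
    filter_upwards [h0] with x hx
    rw [← ENNReal.rpow_mul, mul_one_div_cancel hq.ne', ENNReal.rpow_one, prodWeight,
      ← Finset.prod_mul_distrib]
    refine Finset.prod_eq_one fun i _ => ?_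
    rw [dualWeight, ← ENNReal.rpow_mul, ← inv_conjExponent_eq_one_sub (hP i), neg_mul,
      mul_inv_cancel₀ (conjExponent_pos (hP i)).ne', ENNReal.rpow_neg_one]
    exact ENNReal.mul_inv_cancel (by exact_mod_cast hx i) ENNReal.coe_ne_top
  ne_top := hK
  cube_le a _ hℓ := withDensity_mul_prod_le_weightConst hP hq ω a hℓ

/-- The density of `|f| dx` with respect to the measure with density `dualWeight p w`. -/
noncomputable def relativeDensity (p : ℝ) (w : (Fin n → ℝ) → ℝ≥0) (f : (Fin n → ℝ) → ℂ)
    (x : Fin n → ℝ) : ℝ≥0∞ :=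
  ‖f x‖ₑ * (w x : ℝ≥0∞) ^ p.conjExponent

theorem measurable_relativeDensity {w : (Fin n → ℝ) → ℝ≥0} {f : (Fin n → ℝ) → ℂ}
    (hw : Measurable w) (hf : Measurable f) (p : ℝ) : Measurable (relativeDensity p w f) :=
  hf.enorm.mul (hw.coe_nnreal_ennreal.pow_const _)

theorem setLIntegral_relativeDensity {w : (Fin n → ℝ) → ℝ≥0} {f : (Fin n → ℝ) → ℂ}
    (hw : Measurable w) (hf : Measurable f) (h0 : ∀ᵐ x, w x ≠ 0) (p : ℝ) {s : Set (Fin n → ℝ)}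
    (hs : MeasurableSet s) :
    ∫⁻ y in s, relativeDensity p w f y ∂(volume.withDensity (dualWeight p w)) =
      ∫⁻ y in s, ‖f y‖ₑ := by
  rw [setLIntegral_withDensity_eq_setLIntegral_mul _ (measurable_dualWeight hw p)
    (measurable_relativeDensity hw hf p) hs]
  refine lintegral_congr_ae (ae_restrict_of_ae ?_)
  filter_upwards [h0] with x hx
  rw [Pi.mul_apply, dualWeight, relativeDensity, mul_left_comm,
    ← ENNReal.rpow_add _ _ (by exact_mod_cast hx) ENNReal.coe_ne_top, neg_add_cancel,
    ENNReal.rpow_zero, mul_one]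

theorem lintegral_relativeDensity_rpow {w : (Fin n → ℝ) → ℝ≥0} {f : (Fin n → ℝ) → ℂ}
    (hw : Measurable w) (hf : Measurable f) (h0 : ∀ᵐ x, w x ≠ 0) {p : ℝ} (hp : 1 < p) :
    ∫⁻ y, relativeDensity p w f y ^ p ∂(volume.withDensity (dualWeight p w)) =
      ∫⁻ y, ‖f y‖ₑ ^ p ∂(volume.withDensity fun x => (w x : ℝ≥0∞) ^ p) := by
  have hexp : -p.conjExponent + p.conjExponent * p = p := by
    have : p - 1 ≠ 0 := by linarith
    rw [Real.conjExponent]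
    field_simp
    ring
  rw [lintegral_withDensity_eq_lintegral_mul _ (measurable_dualWeight hw p)
      ((measurable_relativeDensity hw hf p).pow_const _),
    lintegral_withDensity_eq_lintegral_mul _ (hw.coe_nnreal_ennreal.pow_const _)
      (hf.enorm.pow_const _)]
  refine lintegral_congr_ae ?_
  filter_upwards [h0] with x hx
  rw [Pi.mul_apply, Pi.mul_apply, dualWeight, relativeDensity,
    ENNReal.mul_rpow_of_nonneg _ _ (by linarith), mul_left_comm, ← ENNReal.rpow_mul,
    ← ENNReal.rpow_add _ _ (by exact_mod_cast hx) ENNReal.coe_ne_top, hexp, mul_comm]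

theorem fracMaximal_eq_measureFracMaximal (hm : 0 < m) (hn : 0 < n) (α : ℝ) (P : Fin m → ℝ)
    (hω : ∀ i, Measurable (ω i)) (hf : ∀ i, Measurable (f i)) (h0 : ∀ᵐ x, ∀ i, ω i x ≠ 0) :
    fracMaximal α f = measureFracMaximal (m - α / n)
      (fun i => volume.withDensity (dualWeight (P i) (ω i)))
      fun i => relativeDensity (P i) (ω i) (f i) := by
  ext x
  refine iSup_congr fun a => iSup_congr fun ℓ => iSup_congr fun hℓ => iSup_congr fun _ => ?_
  rw [prod_rpow_inv_mul_eq hm hn α (volume_cube_ne_zero a hℓ) (volume_cube_ne_top a ℓ)]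
  congr 1
  exact Finset.prod_congr rfl fun i _ => (setLIntegral_relativeDensity (hω i) (hf i)
    (h0.mono fun x hx => hx i) _ (measurableSet_cube a ℓ)).symm

end Weights

section UpperBound

variable {P : Fin m → ℝ} {q κ α : ℝ} {r : Fin m → ℝ} (hm : 0 < m) (hn : 0 < n)
  (D : OrderSplitting P q κ r) (hs : totalExponent P q = m - α / n)

include hm hn D hs

theorem exists_lintegral_fracMaximal_rpow_le :
    ∃ C : ℝ≥0, ∀ ω : Fin m → (Fin n → ℝ) → ℝ≥0, (∀ i, Measurable (ω i)) →
      weightConst P q ω ≠ ∞ → ∀ f : Fin m → (Fin n → ℝ) → ℂ, (∀ i, Measurable (f i)) →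
      ∫⁻ x, fracMaximal α f x ^ q ∂(volume.withDensity fun x => prodWeight ω x ^ q) ≤
        C * weightConst P q ω ^ κ * ∏ i,
          (∫⁻ x, ‖f i x‖ₑ ^ P i ∂(volume.withDensity fun x => (ω i x : ℝ≥0∞) ^ P i)) ^
            (q / P i) := by
  obtain ⟨C, hC⟩ := exists_lintegral_measureFracMaximal_rpow_le n D
  refine ⟨C, fun ω hω hK f hf => ?_⟩
  obtain hν | hν := eq_or_ne (volume.withDensity fun x => prodWeight ω x ^ q) 0
  · rw [hν, lintegral_zero_measure]
    exact zero_le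
  have h0 := ae_weight_ne_zero D.one_lt D.q_pos hω hK hν
  have hle := hC _ (fun i => relativeDensity (P i) (ω i) (f i)) _ _
    (isMuckenhouptSystem_dualWeight D.one_lt D.q_pos hω hK h0)
    fun i => measurable_relativeDensity (hω i) (hf i) _
  simp only [lintegral_relativeDensity_rpow (hω _) (hf _) (h0.mono fun _ hx => hx _)
    (D.one_lt _)] at hle
  rwa [fracMaximal_eq_measureFracMaximal hm hn α P hω hf h0, ← hs]

theorem exists_eLpNorm_fracMaximal_le :
    ∃ C : ℝ≥0, ∀ ω : Fin m → (Fin n → ℝ) → ℝ≥0, (∀ i, Measurable (ω i)) →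
      weightConst P q ω ≠ ∞ → ∀ f : Fin m → (Fin n → ℝ) → ℂ, (∀ i, Measurable (f i)) →
      eLpNorm (fracMaximal α f) (ENNReal.ofReal q)
          (volume.withDensity fun x => prodWeight ω x ^ q) ≤
        C * weightConst P q ω ^ (κ / q) *
          ∏ i, eLpNorm (f i) (ENNReal.ofReal (P i))
            (volume.withDensity fun x => (ω i x : ℝ≥0∞) ^ P i) := by
  obtain ⟨C, hC⟩ := exists_lintegral_fracMaximal_rpow_le hm hn D hs
  have hq : 0 ≤ 1 / q := (one_div_pos.2 D.q_pos).le
  refine ⟨C ^ (1 / q), fun ω hω hK f hf => ?_⟩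
  rw [eLpNorm_ofReal_eq_lintegral_rpow _ _ D.q_pos]
  simp only [eLpNorm_ofReal_eq_lintegral_rpow _ _ (one_pos.trans (D.one_lt _)), enorm_eq_self]
  refine (ENNReal.rpow_le_rpow (hC ω hω hK f hf) hq).trans_eq ?_
  rw [ENNReal.mul_rpow_of_nonneg _ _ hq, ENNReal.mul_rpow_of_nonneg _ _ hq,
    ← ENNReal.rpow_mul, mul_one_div, ← ENNReal.prod_rpow_of_nonneg hq,
    ENNReal.coe_rpow_of_nonneg _ hq]
  congr 1
  refine Finset.prod_congr rfl fun i _ => ?_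
  rw [← ENNReal.rpow_mul, div_mul_div_comm, mul_one, mul_comm (P i),
    div_mul_cancel_left₀ D.q_pos.ne', one_div]

theorem div_mem_admissiblePowers : κ / q ∈ admissiblePowers n α P q := by
  obtain ⟨C, hC⟩ := exists_eLpNorm_fracMaximal_le hm hn D hs
  refine ⟨C, fun ω hω f hf => ?_⟩
  choose ω' hω'_meas hω' using hω.1
  choose f' hf'_meas hf' using hf
  have hK := hω.2
  rw [weightConst_congr_ae hω'] at hK ⊢
  rw [withDensity_prodWeight_congr_ae hω', fracMaximal_congr_ae α hf',
    Finset.prod_congr rfl fun i _ => eLpNorm_weight_congr_ae (hω' i) (hf' i) (P i) _]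
  exact hC ω' hω'_meas hK.ne f' hf'_meas

end UpperBound

end MultipleWeights

/-! ### Power weights and the lower bound -/

theorem enorm_rpow_eq_ofReal {E : Type*} [NormedAddCommGroup E] {x : E} (hx : x ≠ 0) (a : ℝ) :
    ‖x‖ₑ ^ a = ENNReal.ofReal (‖x‖ ^ a) := by
  rw [← ofReal_norm, ENNReal.ofReal_rpow_of_pos (norm_pos_iff.2 hx)]

theorem prod_rpow_eq_rpow_sum_of_nonneg {ι : Type*} (s : Finset ι) (x : ℝ≥0∞) {f : ι → ℝ}
    (hf : ∀ i ∈ s, 0 ≤ f i) : ∏ i ∈ s, x ^ f i = x ^ ∑ i ∈ s, f i := by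
  induction s using Finset.cons_induction with
  | empty => simp
  | cons i s hi ih =>
    rw [Finset.forall_mem_cons] at hf
    rw [Finset.prod_cons, Finset.sum_cons, ih hf.2,
      ENNReal.rpow_add_of_nonneg _ _ hf.1 (Finset.sum_nonneg hf.2)]

section RadialIntegral

variable {E : Type*} [NormedAddCommGroup E] [NormedSpace ℝ E] [FiniteDimensional ℝ E]
  [Nontrivial E] [MeasurableSpace E] [BorelSpace E] (μ : Measure E) [μ.IsAddHaarMeasure]
  {ε R : ℝ}

theorem eqOn_pow_smul_indicator_rpow {d : ℕ} (hd : 0 < d) (ε R : ℝ) :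
    Set.EqOn (fun y => y ^ (d - 1) • (Set.Iic R).indicator (fun t => t ^ (ε - d)) y)
      ((Set.Ioc 0 R).indicator fun t => t ^ (ε - 1)) (Set.Ioi 0) := by
  intro y hy
  rw [Set.mem_Ioi] at hy
  by_cases h : y ≤ R
  · simp only [Set.indicator, Set.mem_Iic, Set.mem_Ioc, hy, h, and_self, if_true, smul_eq_mul]
    rw [← Real.rpow_natCast, ← Real.rpow_add hy, Nat.cast_pred hd]
    congr 1
    ring
  · simp [h]

theorem integrable_indicator_norm_rpow (hε : 0 < ε) :
    Integrable (fun x : E =>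
      (Set.Iic R).indicator (fun t => t ^ (ε - Module.finrank ℝ E)) ‖x‖) μ := by
  have hint : IntegrableOn (fun y : ℝ => y ^ (ε - 1)) (Set.Ioc 0 R) :=
    (intervalIntegral.intervalIntegrable_rpow' (by linarith)).1
  rw [integrable_fun_norm_addHaar, integrableOn_congr_fun
    (eqOn_pow_smul_indicator_rpow Module.finrank_pos ε R) measurableSet_Ioi]
  exact (hint.integrable_indicator measurableSet_Ioc).integrableOn

theorem integral_indicator_norm_rpow (hε : 0 < ε) (hR : 0 ≤ R) :
    ∫ x : E, (Set.Iic R).indicator (fun t => t ^ (ε - Module.finrank ℝ E)) ‖x‖ ∂μ =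
      Module.finrank ℝ E * μ.real (Metric.ball 0 1) * R ^ ε / ε := by
  rw [integral_fun_norm_addHaar, setIntegral_congr_fun measurableSet_Ioi
    (eqOn_pow_smul_indicator_rpow Module.finrank_pos ε R),
    setIntegral_indicator measurableSet_Ioc, Set.inter_eq_right.2 Set.Ioc_subset_Ioi_self,
    ← intervalIntegral.integral_of_le hR, integral_rpow (.inl (by linarith)), sub_add_cancel,
    Real.zero_rpow hε.ne', sub_zero, smul_eq_mul, nsmul_eq_mul]
  ring

theorem setLIntegral_closedBall_enorm_rpow (hε : 0 < ε) (hR : 0 ≤ R) :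
    ∫⁻ x in Metric.closedBall (0 : E) R, ‖x‖ₑ ^ (ε - Module.finrank ℝ E) ∂μ =
      ENNReal.ofReal (Module.finrank ℝ E * μ.real (Metric.ball 0 1) * R ^ ε / ε) := by
  rw [← integral_indicator_norm_rpow μ hε hR,
    ofReal_integral_eq_lintegral_ofReal (integrable_indicator_norm_rpow μ hε)
      (.of_forall fun x => Set.indicator_apply_nonneg fun _ => Real.rpow_nonneg (norm_nonneg _) _),
    ← lintegral_indicator measurableSet_closedBall]
  refine lintegral_congr_ae ?_
  filter_upwards [Measure.ae_ne μ 0] with x hx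
  by_cases h : ‖x‖ ≤ R
  · simp [Set.indicator, h, enorm_rpow_eq_ofReal hx]
  · simp [Set.indicator, h]

end RadialIntegral

section Average

variable {X : Type*} [MeasurableSpace X] {μ : Measure X} {s : Set X} {f : X → ℝ≥0∞} {c : ℝ≥0∞}

theorem setLAverage_le_of_forall_le (hs : MeasurableSet s) (h0 : μ s ≠ 0) (htop : μ s ≠ ∞)
    (h : ∀ x ∈ s, f x ≤ c) : ⨍⁻ x in s, f x ∂μ ≤ c :=
  (laverage_mono_ae (ae_restrict_of_forall_mem hs h)).trans_eq (setLAverage_const h0 htop c)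

theorem le_setLAverage_of_forall_le (hs : MeasurableSet s) (h0 : μ s ≠ 0) (htop : μ s ≠ ∞)
    (h : ∀ x ∈ s, c ≤ f x) : c ≤ ⨍⁻ x in s, f x ∂μ :=
  (setLAverage_const h0 htop c).symm.trans_le
    (laverage_mono_ae (ae_restrict_of_forall_mem hs h))

end Average

section PowerAverages

variable {n : ℕ} {δ ℓ : ℝ} {a : Fin n → ℝ}

theorem ae_ne_zero_of_pos (hn : 0 < n) : ∀ᵐ x : Fin n → ℝ, x ≠ 0 :=
  have : Nonempty (Fin n) := ⟨⟨0, hn⟩⟩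
  Measure.ae_ne volume 0

theorem setLIntegral_closedBall_enorm_rpow_pi (hn : 0 < n) {ε R : ℝ} (hε : 0 < ε) (hR : 0 ≤ R) :
    ∫⁻ x in Metric.closedBall (0 : Fin n → ℝ) R, ‖x‖ₑ ^ (ε - n) =
      ENNReal.ofReal (n * 2 ^ n * R ^ ε / ε) := by
  have : Nonempty (Fin n) := ⟨⟨0, hn⟩⟩
  have hball : volume.real (Metric.ball (0 : Fin n → ℝ) 1) = 2 ^ n := by
    rw [measureReal_def, Real.volume_pi_ball _ one_pos, ENNReal.toReal_ofReal (by positivity)]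
    simp
  simpa only [Module.finrank_fin_fun, hball] using
    setLIntegral_closedBall_enorm_rpow (E := Fin n → ℝ) volume hε hR

theorem norm_le_norm_add_of_mem_cube {x y : Fin n → ℝ} (hℓ : 0 ≤ ℓ) (hx : x ∈ cube a ℓ)
    (hy : y ∈ cube a ℓ) : ‖x‖ ≤ ‖y‖ + ℓ := by
  have h : ‖x - y‖ ≤ ℓ := mem_closedBall_iff_norm.1 (cube_subset_closedBall hy hℓ le_rfl hx)
  linarith [norm_sub_norm_le x y]

theorem exists_bounds_of_near_origin (hn : 0 < n) (hδ0 : 0 < δ) (hδ : δ ≤ n) (hℓ : 0 < ℓ)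
    {y : Fin n → ℝ} (hy : y ∈ cube a ℓ) (hyℓ : ‖y‖ ≤ ℓ) :
    ∃ U V : ℝ≥0∞, (∀ x ∈ cube a ℓ, ‖x‖ₑ ^ (n - δ) ≤ U) ∧
      ⨍⁻ x in cube a ℓ, ‖x‖ₑ ^ (δ - n) ∂volume ≤ V ∧ U * V ≤ ENNReal.ofReal (n * 4 ^ n / δ) := by
  have hsub : cube a ℓ ⊆ Metric.closedBall 0 (2 * ℓ) := fun x hx => by
    rw [mem_closedBall_zero_iff]
    linarith [norm_le_norm_add_of_mem_cube hℓ.le hx hy]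
  refine ⟨ENNReal.ofReal ((2 * ℓ) ^ (n - δ)), ENNReal.ofReal (n * 2 ^ n * (2 * ℓ) ^ δ / δ / ℓ ^ n),
    fun x hx => ?_, ?_, ?_⟩
  · rw [← ENNReal.ofReal_rpow_of_pos (by positivity), ← ofReal_norm]
    gcongr
    exact mem_closedBall_zero_iff.1 (hsub hx)
  · rw [setLAverage_eq, volume_cube, ← ENNReal.ofReal_pow hℓ.le,
      ENNReal.ofReal_div_of_pos (y := ℓ ^ n) (by positivity),
      ← setLIntegral_closedBall_enorm_rpow_pi hn hδ0 (by positivity : 0 ≤ 2 * ℓ)]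
    exact ENNReal.div_le_div_right (lintegral_mono_set hsub) _
  · have e : (2 * ℓ) ^ (n - δ) * (2 * ℓ) ^ δ = 2 ^ n * ℓ ^ n := by
      rw [← Real.rpow_add (by positivity), sub_add_cancel, Real.rpow_natCast, mul_pow]
    rw [← ENNReal.ofReal_mul (by positivity)]
    refine le_of_eq (congrArg _ ?_)
    calc (2 * ℓ) ^ (n - δ) * (n * 2 ^ n * (2 * ℓ) ^ δ / δ / ℓ ^ n)
        = ((2 * ℓ) ^ (n - δ) * (2 * ℓ) ^ δ) * (n * 2 ^ n / δ / ℓ ^ n) := by ring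
      _ = n * (2 * 2) ^ n / δ := by
        rw [e, mul_pow 2 2]
        field_simp
      _ = n * 4 ^ n / δ := by norm_num

theorem exists_bounds_of_far_from_origin (hn : 0 < n) (hδ0 : 0 < δ) (hδ : δ ≤ 1) (hℓ : 0 < ℓ)
    (hfar : ∀ x ∈ cube a ℓ, ℓ < ‖x‖) :
    ∃ U V : ℝ≥0∞, (∀ x ∈ cube a ℓ, ‖x‖ₑ ^ (n - δ) ≤ U) ∧
      ⨍⁻ x in cube a ℓ, ‖x‖ₑ ^ (δ - n) ∂volume ≤ V ∧ U * V ≤ ENNReal.ofReal (n * 4 ^ n / δ) := by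
  have hn1 : (1 : ℝ) ≤ n := by exact_mod_cast hn
  have ha : a ∈ cube a ℓ := fun j => ⟨le_rfl, by linarith⟩
  have hρ := hfar a ha
  set ρ := ‖a‖
  have hρ0 : 0 < ρ := hℓ.trans hρ
  refine ⟨ENNReal.ofReal ((2 * ρ) ^ (n - δ)), ENNReal.ofReal ((ρ / 2) ^ (δ - n)),
    fun x hx => ?_, ?_, ?_⟩
  · rw [← ENNReal.ofReal_rpow_of_pos (by positivity), ← ofReal_norm]
    gcongr
    · linarith
    · linarith [norm_le_norm_add_of_mem_cube hℓ.le hx ha]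
  · refine setLAverage_le_of_forall_le (measurableSet_cube a ℓ) (volume_cube_ne_zero a hℓ)
      (volume_cube_ne_top a ℓ) fun x hx => ?_
    have hxℓ := hfar x hx
    have hax := norm_le_norm_add_of_mem_cube hℓ.le ha hx
    rw [enorm_rpow_eq_ofReal (norm_pos_iff.1 (hℓ.trans hxℓ))]
    exact ENNReal.ofReal_le_ofReal
      (Real.rpow_le_rpow_of_nonpos (by positivity) (by linarith) (by linarith))
  · rw [← ENNReal.ofReal_mul (by positivity)]
    refine ENNReal.ofReal_le_ofReal ?_
    calc (2 * ρ) ^ (n - δ) * (ρ / 2) ^ (δ - n) = 4 ^ (n - δ) := by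
          rw [← neg_sub (n : ℝ) δ, Real.rpow_neg (by positivity), ← div_eq_mul_inv,
            ← Real.div_rpow (by positivity) (by positivity)]
          congr 1
          field_simp
          norm_num
      _ ≤ 4 ^ (n : ℝ) := Real.rpow_le_rpow_of_exponent_le (by norm_num) (by linarith)
      _ = 4 ^ n := Real.rpow_natCast _ _
      _ ≤ n * 4 ^ n / δ := by
          rw [le_div_iff₀ hδ0, mul_comm]
          gcongr
          linarith

theorem setLAverage_enorm_rpow_mul_le (hn : 0 < n) {T : ℝ} (hδ0 : 0 < δ) (hδ : δ ≤ 1)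
    (hT : 0 ≤ T) (a : Fin n → ℝ) (hℓ : 0 < ℓ) :
    (⨍⁻ x in cube a ℓ, ‖x‖ₑ ^ ((n - δ) * T) ∂volume) *
      (⨍⁻ x in cube a ℓ, ‖x‖ₑ ^ (δ - n) ∂volume) ^ T ≤
    ENNReal.ofReal (n * 4 ^ n / δ) ^ T := by
  have hn1 : (1 : ℝ) ≤ n := by exact_mod_cast hn
  obtain ⟨U, V, hU, hV, hUV⟩ : ∃ U V : ℝ≥0∞, (∀ x ∈ cube a ℓ, ‖x‖ₑ ^ (n - δ) ≤ U) ∧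
      ⨍⁻ x in cube a ℓ, ‖x‖ₑ ^ (δ - n) ∂volume ≤ V ∧ U * V ≤ ENNReal.ofReal (n * 4 ^ n / δ) := by
    by_cases hnear : ∃ y ∈ cube a ℓ, ‖y‖ ≤ ℓ
    · obtain ⟨y, hy, hyℓ⟩ := hnear
      exact exists_bounds_of_near_origin hn hδ0 (hδ.trans hn1) hℓ hy hyℓ
    · push Not at hnear
      exact exists_bounds_of_far_from_origin hn hδ0 hδ hℓ hnear
  calc _ ≤ U ^ T * V ^ T := by
        gcongr
        refine setLAverage_le_of_forall_le (measurableSet_cube a ℓ) (volume_cube_ne_zero a hℓ)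
          (volume_cube_ne_top a ℓ) fun x hx => ?_
        rw [ENNReal.rpow_mul]
        exact ENNReal.rpow_le_rpow (hU x hx) hT
    _ = (U * V) ^ T := (ENNReal.mul_rpow_of_nonneg _ _ hT).symm
    _ ≤ _ := ENNReal.rpow_le_rpow hUV hT

theorem one_le_norm_of_mem_cube_one (hn : 0 < n) {x : Fin n → ℝ}
    (hx : x ∈ cube (fun _ : Fin n => (1 : ℝ)) ℓ) : 1 ≤ ‖x‖ :=
  ((hx ⟨0, hn⟩).1.trans (le_abs_self _)).trans (norm_le_pi_norm x ⟨0, hn⟩)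

theorem norm_le_two_of_mem_cube_one {x : Fin n → ℝ}
    (hx : x ∈ cube (fun _ : Fin n => (1 : ℝ)) 1) : ‖x‖ ≤ 2 := by
  refine (pi_norm_le_iff_of_nonneg (by norm_num)).2 fun j => ?_
  have := hx j
  rw [Real.norm_eq_abs, abs_le]
  constructor <;> linarith

theorem le_setLAverage_cube_one_mul (hn : 0 < n) {T : ℝ} (hδ0 : 0 ≤ δ) (hδ : δ ≤ n)
    (hT : 0 ≤ T) :
    ENNReal.ofReal (2 ^ (-(n : ℝ))) ^ T ≤
      (⨍⁻ x in cube (fun _ : Fin n => (1 : ℝ)) 1, ‖x‖ₑ ^ ((n - δ) * T) ∂volume) *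
        (⨍⁻ x in cube (fun _ : Fin n => (1 : ℝ)) 1, ‖x‖ₑ ^ (δ - n) ∂volume) ^ T := by
  have hmeas := measurableSet_cube (fun _ : Fin n => (1 : ℝ)) 1
  have h0 := volume_cube_ne_zero (fun _ : Fin n => (1 : ℝ)) one_pos
  have htop := volume_cube_ne_top (fun _ : Fin n => (1 : ℝ)) 1
  have hweight : 1 ≤ ⨍⁻ x in cube (fun _ : Fin n => (1 : ℝ)) 1, ‖x‖ₑ ^ ((n - δ) * T) ∂volume := by
    refine le_setLAverage_of_forall_le hmeas h0 htop fun x hx => ?_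
    rw [← ENNReal.one_rpow ((n - δ) * T)]
    refine ENNReal.rpow_le_rpow ?_ (mul_nonneg (by linarith) hT)
    rw [← ofReal_norm, ENNReal.one_le_ofReal]
    exact one_le_norm_of_mem_cube_one hn hx
  have hdual : ENNReal.ofReal (2 ^ (-(n : ℝ))) ≤
      ⨍⁻ x in cube (fun _ : Fin n => (1 : ℝ)) 1, ‖x‖ₑ ^ (δ - n) ∂volume := by
    refine le_setLAverage_of_forall_le hmeas h0 htop fun x hx => ?_
    have hx0 : 0 < ‖x‖ := one_pos.trans_le (one_le_norm_of_mem_cube_one hn hx)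
    rw [enorm_rpow_eq_ofReal (norm_pos_iff.1 hx0)]
    refine ENNReal.ofReal_le_ofReal ?_
    calc (2 : ℝ) ^ (-(n : ℝ)) ≤ 2 ^ (δ - n) :=
          Real.rpow_le_rpow_of_exponent_le (by norm_num) (by linarith)
      _ ≤ ‖x‖ ^ (δ - n) :=
          Real.rpow_le_rpow_of_nonpos hx0 (norm_le_two_of_mem_cube_one hx) (by linarith)
  calc _ = 1 * ENNReal.ofReal (2 ^ (-(n : ℝ))) ^ T := (one_mul _).symm
    _ ≤ _ := by gcongr

end PowerAverages

section PowerWeights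

variable {n m : ℕ} {P : Fin m → ℝ} {q δ : ℝ}

/-- The power weights `‖x‖ ^ ((n - δ) / pᵢ')`, whose dual weights `‖x‖ ^ (δ - n)` all coincide and
become non-integrable at the origin as `δ → 0`. -/
noncomputable def powerWeight (n : ℕ) (P : Fin m → ℝ) (δ : ℝ) (i : Fin m) (x : Fin n → ℝ) : ℝ≥0 :=
  ‖x‖₊ ^ ((n - δ) * (1 - 1 / P i))

theorem measurable_powerWeight (P : Fin m → ℝ) (δ : ℝ) (i : Fin m) :
    Measurable (powerWeight n P δ i) :=
  measurable_nnnorm.pow_const _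

theorem sum_one_sub_one_div_nonneg (hP : ∀ i, 1 < P i) : 0 ≤ ∑ i, (1 - 1 / P i) :=
  Finset.sum_nonneg fun i _ => (one_sub_one_div_pos (hP i)).le

theorem coe_powerWeight (hP : ∀ i, 1 < P i) (hδ : δ ≤ n) (i : Fin m) (x : Fin n → ℝ) :
    (powerWeight n P δ i x : ℝ≥0∞) = ‖x‖ₑ ^ ((n - δ) * (1 - 1 / P i)) :=
  ENNReal.coe_rpow_of_nonneg _ (mul_nonneg (sub_nonneg.2 hδ) (one_sub_one_div_pos (hP i)).le)

theorem coe_powerWeight_rpow_neg (hP : ∀ i, 1 < P i) (hδ : δ ≤ n) (i : Fin m) (x : Fin n → ℝ) :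
    (powerWeight n P δ i x : ℝ≥0∞) ^ (-(P i).conjExponent) = ‖x‖ₑ ^ (δ - n) := by
  have hc := (conjExponent_pos (hP i)).ne'
  rw [coe_powerWeight hP hδ, ← ENNReal.rpow_mul, ← inv_conjExponent_eq_one_sub (hP i)]
  congr 1
  field_simp
  ring

theorem prodWeight_powerWeight_rpow (hP : ∀ i, 1 < P i) (hδ : δ ≤ n) (q : ℝ) (x : Fin n → ℝ) :
    prodWeight (powerWeight n P δ) x ^ q = ‖x‖ₑ ^ ((n - δ) * (q * ∑ i, (1 - 1 / P i))) := by
  simp only [prodWeight, coe_powerWeight hP hδ]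
  rw [prod_rpow_eq_rpow_sum_of_nonneg _ _
    fun i _ => mul_nonneg (sub_nonneg.2 hδ) (one_sub_one_div_pos (hP i)).le, ← Finset.mul_sum,
    ← ENNReal.rpow_mul, mul_assoc, mul_comm q]

theorem setLAverage_powerWeight_mul_prod_eq (hP : ∀ i, 1 < P i) (hq : 0 ≤ q) (hδ : δ ≤ n)
    (s : Set (Fin n → ℝ)) :
    (⨍⁻ x in s, prodWeight (powerWeight n P δ) x ^ q ∂volume) *
      ∏ i, (⨍⁻ x in s, (powerWeight n P δ i x : ℝ≥0∞) ^ (-(P i).conjExponent) ∂volume) ^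
        (q / (P i).conjExponent) =
    (⨍⁻ x in s, ‖x‖ₑ ^ ((n - δ) * (q * ∑ i, (1 - 1 / P i))) ∂volume) *
      (⨍⁻ x in s, ‖x‖ₑ ^ (δ - n) ∂volume) ^ (q * ∑ i, (1 - 1 / P i)) := by
  simp only [prodWeight_powerWeight_rpow hP hδ, coe_powerWeight_rpow_neg hP hδ, div_eq_mul_inv q,
    inv_conjExponent_eq_one_sub (hP _)]
  rw [prod_rpow_eq_rpow_sum_of_nonneg _ _
    fun i _ => mul_nonneg hq (one_sub_one_div_pos (hP i)).le, Finset.mul_sum]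

theorem weightConst_powerWeight_le (hn : 0 < n) (hP : ∀ i, 1 < P i) (hq : 0 ≤ q) (hδ0 : 0 < δ)
    (hδ : δ ≤ 1) :
    weightConst P q (powerWeight n P δ) ≤
      ENNReal.ofReal (n * 4 ^ n / δ) ^ (q * ∑ i, (1 - 1 / P i)) := by
  refine iSup_le fun a => iSup_le fun ℓ => iSup_le fun hℓ => ?_
  rw [setLAverage_powerWeight_mul_prod_eq hP hq (hδ.trans (by exact_mod_cast hn))]
  exact setLAverage_enorm_rpow_mul_le hn hδ0 hδ (mul_nonneg hq (sum_one_sub_one_div_nonneg hP)) a hℓ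

theorem le_weightConst_powerWeight (hn : 0 < n) (hP : ∀ i, 1 < P i) (hq : 0 ≤ q) (hδ0 : 0 ≤ δ)
    (hδ : δ ≤ n) :
    ENNReal.ofReal (2 ^ (-(n : ℝ))) ^ (q * ∑ i, (1 - 1 / P i)) ≤
      weightConst P q (powerWeight n P δ) := by
  refine le_trans ?_ (le_weightConst P q (powerWeight n P δ) (fun _ => 1) one_pos)
  rw [setLAverage_powerWeight_mul_prod_eq hP hq hδ]
  exact le_setLAverage_cube_one_mul hn hδ0 hδ (mul_nonneg hq (sum_one_sub_one_div_nonneg hP))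

theorem isWeight_powerWeight (hn : 0 < n) (hP : ∀ i, 1 < P i) (hq : 0 ≤ q) (hδ0 : 0 < δ)
    (hδ : δ ≤ 1) : IsWeight P q (powerWeight n P δ) :=
  ⟨fun i => (measurable_powerWeight P δ i).aemeasurable,
    (weightConst_powerWeight_le hn hP hq hδ0 hδ).trans_lt (ENNReal.rpow_lt_top_of_nonneg
      (mul_nonneg hq (sum_one_sub_one_div_nonneg hP)) ENNReal.ofReal_ne_top)⟩

theorem exists_weightConst_powerWeight_rpow_le (hn : 0 < n) (hP : ∀ i, 1 < P i) (hq : 0 ≤ q)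
    (γ : ℝ) :
    ∃ c : ℝ, 0 < c ∧ ∀ δ : ℝ, 0 < δ → δ ≤ 1 → weightConst P q (powerWeight n P δ) ^ γ ≤
      ENNReal.ofReal (c * (1 / δ) ^ (q * (∑ i, (1 - 1 / P i)) * max γ 0)) := by
  have hn1 : (1 : ℝ) ≤ n := by exact_mod_cast hn
  set T := q * ∑ i, (1 - 1 / P i) with hT
  rcases le_total 0 γ with hγ | hγ
  · refine ⟨(n * 4 ^ n) ^ (T * γ), by positivity, fun δ hδ0 hδ => ?_⟩
    refine (ENNReal.rpow_le_rpow (weightConst_powerWeight_le hn hP hq hδ0 hδ) hγ).trans_eq ?_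
    rw [← ENNReal.rpow_mul, ENNReal.ofReal_rpow_of_pos (by positivity), max_eq_left hγ, ← hT,
      ← Real.mul_rpow (by positivity) (by positivity), mul_one_div]
  · -- a negative power needs the lower bound for the constant
    refine ⟨((2 : ℝ) ^ (-(n : ℝ))) ^ (T * γ), by positivity, fun δ hδ0 hδ => ?_⟩
    rw [max_eq_right hγ, mul_zero, Real.rpow_zero, mul_one,
      ← ENNReal.ofReal_rpow_of_pos (by positivity), ENNReal.rpow_mul, ← neg_neg γ,
      ENNReal.rpow_neg, ENNReal.rpow_neg _ (-γ), ENNReal.inv_le_inv]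
    exact ENNReal.rpow_le_rpow (le_weightConst_powerWeight hn hP hq hδ0.le (hδ.trans hn1))
      (neg_nonneg.2 hγ)

end PowerWeights

section PowerFunction

variable {n m : ℕ} {P : Fin m → ℝ} {q α δ : ℝ}

/-- The test function `‖x‖ ^ (δ - n)` on the unit ball, which is extremal for the power weights
`powerWeight n P δ`. -/
noncomputable def powerFun (n : ℕ) (δ : ℝ) : (Fin n → ℝ) → ℂ :=
  (Metric.closedBall 0 1).indicator fun x => ((‖x‖ ^ (δ - n) : ℝ) : ℂ)

theorem measurable_powerFun (δ : ℝ) : Measurable (powerFun n δ) :=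
  (Complex.measurable_ofReal.comp (measurable_norm.pow_const _)).indicator measurableSet_closedBall

theorem enorm_powerFun {x : Fin n → ℝ} (hx : x ≠ 0) (hx1 : ‖x‖ ≤ 1) :
    ‖powerFun n δ x‖ₑ = ‖x‖ₑ ^ (δ - n) := by
  rw [powerFun, Set.indicator_of_mem (mem_closedBall_zero_iff.2 hx1), enorm_rpow_eq_ofReal hx,
    ← ofReal_norm, Complex.norm_real, Real.norm_of_nonneg (by positivity)]

theorem powerFun_eq_zero {x : Fin n → ℝ} (hx1 : ¬ ‖x‖ ≤ 1) : powerFun n δ x = 0 :=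
  Set.indicator_of_notMem (by rwa [mem_closedBall_zero_iff]) _

theorem eLpNorm_powerFun (hn : 0 < n) (hP : ∀ i, 1 < P i) (hδ0 : 0 < δ) (hδ : δ ≤ n) (i : Fin m) :
    eLpNorm (powerFun n δ) (ENNReal.ofReal (P i))
        (volume.withDensity fun x => (powerWeight n P δ i x : ℝ≥0∞) ^ P i) =
      ENNReal.ofReal (n * 2 ^ n / δ) ^ (1 / P i) := by
  have hPi : 0 < P i := one_pos.trans (hP i)
  have hI := setLIntegral_closedBall_enorm_rpow_pi hn hδ0 zero_le_one
  rw [Real.one_rpow, mul_one] at hI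
  rw [eLpNorm_ofReal_eq_lintegral_rpow _ _ hPi, lintegral_withDensity_eq_lintegral_mul _
    ((measurable_powerWeight P δ i).coe_nnreal_ennreal.pow_const _)
    ((measurable_powerFun δ).enorm.pow_const _), ← hI,
    ← lintegral_indicator measurableSet_closedBall]
  congr 1
  refine lintegral_congr_ae ?_
  filter_upwards [ae_ne_zero_of_pos hn] with x hx
  by_cases hx1 : ‖x‖ ≤ 1
  · rw [Set.indicator_of_mem (mem_closedBall_zero_iff.2 hx1), Pi.mul_apply,
      enorm_powerFun hx hx1, coe_powerWeight hP hδ, ← ENNReal.rpow_mul, ← ENNReal.rpow_mul,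
      ← ENNReal.rpow_add _ _ (enorm_ne_zero.2 hx) enorm_ne_top]
    congr 1
    field_simp
    ring
  · rw [Set.indicator_of_notMem (by rwa [mem_closedBall_zero_iff]), Pi.mul_apply,
      powerFun_eq_zero hx1, enorm_zero, ENNReal.zero_rpow_of_pos hPi, mul_zero]

theorem prod_eLpNorm_powerFun (hn : 0 < n) (hP : ∀ i, 1 < P i) (hδ0 : 0 < δ) (hδ : δ ≤ n) :
    ∏ i, eLpNorm (powerFun n δ) (ENNReal.ofReal (P i))
        (volume.withDensity fun x => (powerWeight n P δ i x : ℝ≥0∞) ^ P i) =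
      ENNReal.ofReal ((n * 2 ^ n / δ) ^ ∑ i, 1 / P i) := by
  have hP0 : ∀ i, 0 < P i := fun i => one_pos.trans (hP i)
  simp only [eLpNorm_powerFun hn hP hδ0 hδ]
  rw [prod_rpow_eq_rpow_sum_of_nonneg _ _ fun i _ => (one_div_pos.2 (hP0 i)).le,
    ENNReal.ofReal_rpow_of_pos (by positivity)]

theorem setLIntegral_closedBall_enorm_powerFun (hn : 0 < n) (hδ0 : 0 < δ) {r : ℝ} (hr0 : 0 ≤ r)
    (hr1 : r ≤ 1) :
    ∫⁻ y in Metric.closedBall 0 r, ‖powerFun n δ y‖ₑ = ENNReal.ofReal (n * 2 ^ n * r ^ δ / δ) := by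
  rw [← setLIntegral_closedBall_enorm_rpow_pi hn hδ0 hr0]
  refine lintegral_congr_ae ?_
  filter_upwards [ae_restrict_mem measurableSet_closedBall,
    ae_restrict_of_ae (ae_ne_zero_of_pos hn)] with y hy hy0
  exact enorm_powerFun hy0 ((mem_closedBall_zero_iff.1 hy).trans hr1)

/-- The constant in the lower bound for `M_α(f, …, f)` with `f = powerFun n δ`. -/
noncomputable def fracMaximalPowerConst (n m : ℕ) (α δ : ℝ) : ℝ :=
  (2 ^ n) ^ (-(m - α / n)) * (n * 2 ^ n / δ) ^ m

theorem fracMaximalPowerConst_nonneg (hδ0 : 0 < δ) : 0 ≤ fracMaximalPowerConst n m α δ := by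
  unfold fracMaximalPowerConst
  positivity

-- average over the cube centred at the origin that has `x` on its boundary
theorem le_fracMaximal_powerFun (hn : 0 < n) (hm : 0 < m) (α : ℝ) (hδ0 : 0 < δ)
    {x : Fin n → ℝ} (hx : x ≠ 0) (hx1 : ‖x‖ ≤ 1) :
    ENNReal.ofReal (fracMaximalPowerConst n m α δ) * ‖x‖ₑ ^ (m * δ - (n * m - α)) ≤
      fracMaximal α (fun _ : Fin m => powerFun n δ) x := by
  have hx0 : 0 < ‖x‖ := norm_pos_iff.2 hx
  have hn' : (n : ℝ) ≠ 0 := by exact_mod_cast hn.ne'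
  have hcube := cube_neg_eq_closedBall (n := n) hx0.le
  have hvol0 := volume_cube_ne_zero (fun _ : Fin n => -‖x‖) (by positivity : 0 < 2 * ‖x‖)
  refine le_trans (le_of_eq ?_) (le_iSup_of_le (fun _ => -‖x‖) (le_iSup_of_le (2 * ‖x‖)
    (le_iSup_of_le (by positivity) (le_iSup_of_le (by rw [hcube]; simp) le_rfl))))
  rw [prod_rpow_inv_mul_eq hm hn α hvol0 (volume_cube_ne_top _ _), Finset.prod_const,
    Finset.card_univ, Fintype.card_fin, volume_cube, hcube,
    setLIntegral_closedBall_enorm_powerFun hn hδ0 hx0.le hx1, enorm_rpow_eq_ofReal hx,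
    ← ENNReal.ofReal_mul (fracMaximalPowerConst_nonneg hδ0),
    ← ENNReal.ofReal_pow (by positivity), ← ENNReal.ofReal_pow (by positivity),
    ENNReal.ofReal_rpow_of_pos (by positivity), ← ENNReal.ofReal_mul (by positivity)]
  have hpow : ‖x‖ ^ (m * δ - (n * m - α)) = (‖x‖ ^ n) ^ (-(m - α / n)) * (‖x‖ ^ δ) ^ m := by
    rw [← Real.rpow_natCast ‖x‖ n, ← Real.rpow_natCast (‖x‖ ^ δ) m, ← Real.rpow_mul hx0.le,
      ← Real.rpow_mul hx0.le, ← Real.rpow_add hx0]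
    congr 1
    field_simp
    ring
  rw [fracMaximalPowerConst, hpow, mul_pow 2 ‖x‖, Real.mul_rpow (by positivity) (by positivity),
    mul_div_right_comm _ (‖x‖ ^ δ), mul_pow _ (‖x‖ ^ δ), mul_mul_mul_comm]

theorem powerWeight_exponent_add (hn : 0 < n) (hq0 : 0 < q)
    (hs : totalExponent P q = m - α / n) (δ : ℝ) :
    (n - δ) * (q * ∑ i, (1 - 1 / P i)) + (m * δ - (n * m - α)) * q =
      δ * (q * ∑ i, 1 / P i) - n := by
  have hn' : (n : ℝ) ≠ 0 := by exact_mod_cast hn.ne'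
  have hsum : ∑ i, (1 - 1 / P i) = m - ∑ i, 1 / P i := by simp [Finset.sum_sub_distrib]
  rw [totalExponent, hsum] at hs
  have hqα : q * α = n * (q * ∑ i, 1 / P i) - n := by
    have hα : α = n * (∑ i, 1 / P i - 1 / q) := by
      field_simp at hs ⊢
      linarith
    rw [hα]
    field_simp
  rw [hsum]
  linear_combination hqα

theorem setLIntegral_enorm_rpow_withDensity_powerWeight (hn : 0 < n) (hP : ∀ i, 1 < P i)
    (hq0 : 0 < q) (hs : totalExponent P q = m - α / n) (hS : 0 < ∑ i, 1 / P i) (hδ0 : 0 < δ)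
    (hδ : δ ≤ n) {A : ℝ} (hA : 0 ≤ A) :
    ∫⁻ x in Metric.closedBall (0 : Fin n → ℝ) 1,
        (ENNReal.ofReal A * ‖x‖ₑ ^ (m * δ - (n * m - α))) ^ q
        ∂(volume.withDensity fun x => prodWeight (powerWeight n P δ) x ^ q) =
      ENNReal.ofReal (A ^ q * (n * 2 ^ n / (δ * (q * ∑ i, 1 / P i)))) := by
  have hI := setLIntegral_closedBall_enorm_rpow_pi hn (ε := δ * (q * ∑ i, 1 / P i))
    (by positivity) zero_le_one
  rw [Real.one_rpow, mul_one] at hI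
  rw [setLIntegral_withDensity_eq_setLIntegral_mul _
    ((measurable_prodWeight (measurable_powerWeight P δ)).pow_const q)
    (((measurable_enorm.pow_const _).const_mul _).pow_const q) measurableSet_closedBall,
    ENNReal.ofReal_mul (by positivity), ← hI, ← lintegral_const_mul' _ _ ENNReal.ofReal_ne_top]
  refine lintegral_congr_ae (ae_restrict_of_ae ?_)
  filter_upwards [ae_ne_zero_of_pos hn] with x hx
  rw [Pi.mul_apply, prodWeight_powerWeight_rpow hP hδ, ENNReal.mul_rpow_of_nonneg _ _ hq0.le,
    ← ENNReal.rpow_mul, mul_left_comm, ← ENNReal.rpow_add _ _ (enorm_ne_zero.2 hx) enorm_ne_top,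
    powerWeight_exponent_add hn hq0 hs, ENNReal.ofReal_rpow_of_nonneg hA hq0.le]

theorem le_eLpNorm_fracMaximal_powerFun (hn : 0 < n) (hm : 0 < m) (hP : ∀ i, 1 < P i)
    (hq0 : 0 < q) (hs : totalExponent P q = m - α / n) (hS : 0 < ∑ i, 1 / P i) (hδ0 : 0 < δ)
    (hδ : δ ≤ n) :
    ENNReal.ofReal (fracMaximalPowerConst n m α δ *
        (n * 2 ^ n / (δ * (q * ∑ i, 1 / P i))) ^ (1 / q)) ≤
      eLpNorm (fracMaximal α fun _ : Fin m => powerFun n δ) (ENNReal.ofReal q)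
        (volume.withDensity fun x => prodWeight (powerWeight n P δ) x ^ q) := by
  set μ := volume.withDensity fun x => prodWeight (powerWeight n P δ) x ^ q with hμ
  set A := fracMaximalPowerConst n m α δ
  have hA : 0 ≤ A := fracMaximalPowerConst_nonneg hδ0
  have hint : ENNReal.ofReal (A ^ q * (n * 2 ^ n / (δ * (q * ∑ i, 1 / P i)))) ≤
      ∫⁻ x, ‖fracMaximal α (fun _ : Fin m => powerFun n δ) x‖ₑ ^ q ∂μ := by
    rw [← setLIntegral_enorm_rpow_withDensity_powerWeight hn hP hq0 hs hS hδ0 hδ hA, ← hμ]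
    refine (lintegral_mono_ae ?_).trans (setLIntegral_le_lintegral (Metric.closedBall 0 1) _)
    filter_upwards [ae_restrict_mem measurableSet_closedBall, ae_restrict_of_ae
      ((withDensity_absolutelyContinuous volume _).ae_le (ae_ne_zero_of_pos hn))] with x hx hx0
    exact ENNReal.rpow_le_rpow
      (le_fracMaximal_powerFun hn hm α hδ0 hx0 (mem_closedBall_zero_iff.1 hx)) hq0.le
  rw [eLpNorm_ofReal_eq_lintegral_rpow _ _ hq0]
  refine le_trans (le_of_eq ?_) (ENNReal.rpow_le_rpow hint (by positivity))
  rw [ENNReal.ofReal_rpow_of_nonneg (by positivity) (by positivity),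
    Real.mul_rpow (by positivity) (by positivity), ← Real.rpow_mul (by positivity),
    mul_one_div_cancel hq0.ne', Real.rpow_one]

end PowerFunction

section LowerBound

variable {n m : ℕ} {P : Fin m → ℝ} {q α γ : ℝ}

theorem le_of_rpow_le_mul_rpow {a b c : ℝ} (h : ∀ t : ℝ, 1 ≤ t → t ^ a ≤ c * t ^ b) : a ≤ b := by
  by_contra! hab
  obtain ⟨t, htc, ht1⟩ := ((tendsto_rpow_atTop (sub_pos.2 hab)).eventually_gt_atTop c
    |>.and (Filter.eventually_ge_atTop 1)).exists
  have ht : 0 < t := one_pos.trans_le ht1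
  have hle := h t ht1
  rw [Real.rpow_sub ht, lt_div_iff₀ (by positivity)] at htc
  linarith

theorem exists_fracMaximalPowerConst_mul_le (hn : 0 < n) (hm : 0 < m) (hP : ∀ i, 1 < P i)
    (hq0 : 0 < q) (hs : totalExponent P q = m - α / n) (hS : 0 < ∑ i, 1 / P i)
    (hγ : γ ∈ admissiblePowers n α P q) :
    ∃ c : ℝ, ∀ δ : ℝ, 0 < δ → δ ≤ 1 →
      fracMaximalPowerConst n m α δ * (n * 2 ^ n / (δ * (q * ∑ i, 1 / P i))) ^ (1 / q) ≤
        c * (1 / δ) ^ (q * (∑ i, (1 - 1 / P i)) * max γ 0) *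
          (n * 2 ^ n / δ) ^ ∑ i, 1 / P i := by
  have hn1 : (1 : ℝ) ≤ n := by exact_mod_cast hn
  obtain ⟨C, hC⟩ := hγ
  obtain ⟨c, hc0, hc⟩ := exists_weightConst_powerWeight_rpow_le hn hP hq0.le γ
  refine ⟨C * c, fun δ hδ0 hδ => ?_⟩
  rw [← ENNReal.ofReal_le_ofReal_iff (by positivity)]
  refine (le_eLpNorm_fracMaximal_powerFun hn hm hP hq0 hs hS hδ0 (hδ.trans hn1)).trans
    ((hC _ (isWeight_powerWeight hn hP hq0.le hδ0 hδ) (fun _ => powerFun n δ)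
      fun _ => (measurable_powerFun _).aemeasurable).trans ?_)
  rw [prod_eLpNorm_powerFun hn hP hδ0 (hδ.trans hn1), mul_assoc (C : ℝ) c,
    ENNReal.ofReal_mul (by positivity), ENNReal.ofReal_mul (by positivity),
    ENNReal.ofReal_coe_nnreal]
  gcongr
  exact hc δ hδ0 hδ

/-- Comparing the powers of `1 / δ` on both sides as `δ → 0`. -/
theorem le_mul_max_of_mem_admissiblePowers (hn : 0 < n) (hm : 0 < m) (hP : ∀ i, 1 < P i)
    (hq0 : 0 < q) (hs : totalExponent P q = m - α / n) (hγ : γ ∈ admissiblePowers n α P q) :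
    m - α / n ≤ q * (∑ i, (1 - 1 / P i)) * max γ 0 := by
  have hn0 : (0 : ℝ) < n := by exact_mod_cast hn
  have hS : 0 < ∑ i, 1 / P i :=
    Finset.sum_pos (fun i _ => one_div_pos.2 (one_pos.trans (hP i))) ⟨⟨0, hm⟩, Finset.mem_univ _⟩
  have hsum : ∑ i, (1 - 1 / P i) = m - ∑ i, 1 / P i := by simp [Finset.sum_sub_distrib]
  obtain ⟨c, hc⟩ := exists_fracMaximalPowerConst_mul_le hn hm hP hq0 hs hS hγ
  set T := q * (∑ i, (1 - 1 / P i)) * max γ 0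
  set S := ∑ i, 1 / P i
  set k : ℝ := (2 ^ n) ^ (-(m - α / n)) * (n * 2 ^ n) ^ m * (n * 2 ^ n / (q * S)) ^ (1 / q) with hk
  have hk0 : 0 < k := by positivity
  have hle := le_of_rpow_le_mul_rpow (a := m + 1 / q) (b := T + S)
    (c := c * (n * 2 ^ n) ^ S / k) fun t ht => by
      have ht0 : 0 < t := one_pos.trans_le ht
      have h := hc (1 / t) (one_div_pos.2 ht0) ((div_le_one ht0).2 ht)
      rw [fracMaximalPowerConst, one_div_mul_eq_div] at h
      simp only [div_div_eq_mul_div, div_one, one_mul] at h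
      rw [mul_div_right_comm _ t, Real.mul_rpow (y := t) (by positivity) ht0.le,
        Real.mul_rpow (y := t) (by positivity) ht0.le, mul_pow _ t] at h
      rw [div_mul_eq_mul_div, le_div_iff₀ hk0, Real.rpow_add ht0, Real.rpow_add ht0,
        Real.rpow_natCast, hk]
      linarith
  rw [totalExponent, hsum] at hs
  linarith

theorem div_mem_lowerBounds_admissiblePowers (hn : 0 < n) (hm : 0 < m) (hP : ∀ i, 1 < P i)
    (hq0 : 0 < q) (hs : totalExponent P q = m - α / n) :
    (m - α / n) / (q * ∑ i, (1 - 1 / P i)) ∈ lowerBounds (admissiblePowers n α P q) := by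
  intro γ hγ
  have hT : 0 < ∑ i, (1 - 1 / P i) :=
    Finset.sum_pos (fun i _ => one_sub_one_div_pos (hP i)) ⟨⟨0, hm⟩, Finset.mem_univ _⟩
  have hpos : 0 < m - α / n := hs ▸ add_pos (one_div_pos.2 hq0) hT
  have h := le_mul_max_of_mem_admissiblePowers hn hm hP hq0 hs hγ
  have hγ0 : 0 < γ := by
    by_contra! hγ0
    rw [max_eq_right hγ0, mul_zero] at h
    linarith
  rwa [max_eq_left hγ0.le, mul_comm, ← div_le_iff₀ (by positivity)] at h

end LowerBound

/-! ### The best power -/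

section BestPower

variable {n m : ℕ} {P : Fin m → ℝ} {p q α : ℝ} (hn : 0 < n) (hP : ∀ i, 1 < P i)

include hn hP

theorem iSup_conjExponent_mem_admissiblePowers (hm : 0 < m) (hα : 0 ≤ α)
    (hαP : α / n < ∑ i, 1 / P i) (hq : 1 / q = ∑ i, 1 / P i - α / n) :
    1 / q * (1 - α / ((m : ℝ) * n)) * (⨆ i, (P i).conjExponent) ∈ admissiblePowers n α P q := by
  obtain ⟨r, D⟩ := exists_orderSplitting hP (by positivity) hαP hq
  convert div_mem_admissiblePowers hm hn D (α := α) (by rw [totalExponent_eq hq, Fintype.card_fin])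
    using 1
  rw [Fintype.card_fin, div_div, mul_comm (n : ℝ)]
  ring

theorem mul_div_mem_lowerBounds_admissiblePowers (hm : 0 < m) (hp0 : 0 < p)
    (hp : 1 / p = ∑ i, 1 / P i) (hq0 : 0 < q) (hq : 1 / q = ∑ i, 1 / P i - α / n) :
    m * p / (q * (m * p - 1)) * (1 - α / ((m : ℝ) * n)) ∈
      lowerBounds (admissiblePowers n α P q) := by
  convert div_mem_lowerBounds_admissiblePowers hn hm hP hq0 (α := α)
    (by rw [totalExponent_eq hq, Fintype.card_fin]) using 1
  have hsum : ∑ i, (1 - 1 / P i) = m - 1 / p := by simp [Finset.sum_sub_distrib, hp]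
  rw [hsum]
  field_simp

end BestPower

end MultilinearFractional

open MultilinearFractional in
/-- For `α = 0` this concerns the multilinear Hardy–Littlewood maximal operator. -/
theorem corollary1p4_general {n m : ℕ} (hn : 0 < n) (P : Fin m → ℝ) (p q α : ℝ)
    (hP : ∀ i, 1 < P i) (hp : 1 / p = ∑ i, 1 / P i) (hα : 0 ≤ α) (hαp : α / n < 1 / p)
    (hq : 1 / q = 1 / p - α / n) :
    1 / q * (1 - α / ((m : ℝ) * n)) * (⨆ i, (P i).conjExponent) ∈
        admissiblePowers n α P q ∧
    m * p / (q * (m * p - 1)) * (1 - α / ((m : ℝ) * n)) ∈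
        lowerBounds (admissiblePowers n α P q) ∧
    m * p / (q * (m * p - 1)) * (1 - α / ((m : ℝ) * n)) ≤
        bestPower n α P q ∧
    bestPower n α P q ≤
        1 / q * (1 - α / ((m : ℝ) * n)) * (⨆ i, (P i).conjExponent) ∧
    ∀ r : ℝ, (∀ i, P i = r) →
      bestPower n α P q =
          r.conjExponent / q * (1 - α / ((m : ℝ) * n)) ∧
      IsLeast (admissiblePowers n α P q)
        (r.conjExponent / q * (1 - α / ((m : ℝ) * n))) := by
  have hp0 : 0 < p := one_div_pos.1 ((by positivity : 0 ≤ α / n).trans_lt hαp)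
  have hq0 : 0 < q := one_div_pos.1 (hq ▸ sub_pos.2 hαp)
  have hm : 0 < m := by
    refine Nat.pos_of_ne_zero ?_
    rintro rfl
    exact (one_div_pos.2 hp0).ne' hp
  have hupper := iSup_conjExponent_mem_admissiblePowers hn hP hm hα (hp ▸ hαp) (hp ▸ hq)
  have hlower := mul_div_mem_lowerBounds_admissiblePowers hn hP hm hp0 hp hq0 (hp ▸ hq)
  refine ⟨hupper, hlower, le_csInf ⟨_, hupper⟩ hlower, csInf_le ⟨_, hlower⟩ hupper,
    fun r hr => ?_⟩
  have : Nonempty (Fin m) := ⟨⟨0, hm⟩⟩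
  have hr0 : 0 < r := one_pos.trans (hr ⟨0, hm⟩ ▸ hP _)
  have hmp : m * p = r := by
    simp only [hr, Finset.sum_const, Finset.card_univ, Fintype.card_fin, nsmul_eq_mul] at hp
    field_simp at hp
    rw [mul_comm, hp]
  have hleast : IsLeast (admissiblePowers n α P q)
      (r.conjExponent / q * (1 - α / ((m : ℝ) * n))) := by
    refine ⟨?_, ?_⟩
    · convert hupper using 1
      simp only [hr, ciSup_const]
      ring
    · rwa [hmp, mul_comm q, ← div_div] at hlower
  exact ⟨hleast.csInf_eq, hleast⟩

theorem corollary1p4 {n m : ℕ} (hn : 0 < n) (hm : 0 < m) (P : Fin m → ℝ) (p q α : ℝ)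
    (hP : ∀ i, 1 < P i) (hp : 1 / p = ∑ i, 1 / P i)
    (hα : 0 < α) (hαmn : α < (m : ℝ) * n)
    (hpm : 1 / (m : ℝ) < p) (hpα : p < n / α) (hq : 1 / q = 1 / p - α / n) :
    -- the upper bound for the best power is itself an admissible power
    1 / q * (1 - α / ((m : ℝ) * n)) * (⨆ i, (P i).conjExponent) ∈
        MultilinearFractional.admissiblePowers n α P q ∧
    -- no power below the lower bound is admissible
    m * p / (q * (m * p - 1)) * (1 - α / ((m : ℝ) * n)) ∈
        lowerBounds (MultilinearFractional.admissiblePowers n α P q) ∧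
    -- the resulting two-sided bound for the best power
    m * p / (q * (m * p - 1)) * (1 - α / ((m : ℝ) * n)) ≤
        MultilinearFractional.bestPower n α P q ∧
    MultilinearFractional.bestPower n α P q ≤
        1 / q * (1 - α / ((m : ℝ) * n)) * (⨆ i, (P i).conjExponent) ∧
    -- equal exponents: the exact value, which is attained and cannot be improved
    ∀ r : ℝ, (∀ i, P i = r) →
      MultilinearFractional.bestPower n α P q =
          r.conjExponent / q * (1 - α / ((m : ℝ) * n)) ∧
      IsLeast (MultilinearFractional.admissiblePowers n α P q)
        (r.conjExponent / q * (1 - α / ((m : ℝ) * n))) :=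
  have hp0 : 0 < p := (one_div_nonneg.2 m.cast_nonneg).trans_lt hpm
  corollary1p4_general hn P p q α hP hp hα.le
    ((lt_one_div (by positivity) hp0).2 (by rwa [one_div_div])) hq
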